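/- Let $d\in\{2,3\}$ and let $X\subset\mathbb R^d$ be a bounded domain (open and connected) with $X=\operatorname{int}\overline X$. Let $\omega_0,\dots,\omega_L$ be unit vectors of $\mathbb R^d$ and $w_0,\dots,w_L>0$ the nodes and weights of an angular quadrature rule. Let $\sigma_t,\sigma_s\in L^\infty(X)$ with $\sigma_s\ge0$ a.e., and let $g(x,t)\ge0$ $(x\in X,\ t\in[-1,1])$ be measurable in $x$ for every $t$. Put $$m(x)=\max_{0\le l\le L}\sum_{i=0}^L w_i\,g(x,\omega_l\cdot\omega_i)$$ and assume that $\sigma_t-m\sigma_s\ge c_0'$ a.e. in $X$ for a constant $c_0'>0$. Let $\bar c>0$. A partition $T_h$ of $X$ is a finite set of (closed) convex polytopes $K$ with nonempty, pairwise disjoint interiors and with union $\overline X$; no shape regularity or conformity is required. Let $n$ be the unit outward normal of $\partial K$, which is defined up to a null set of the boundary, and $$\partial^l_-K=\{x\in\partial K:\omega_l\cdot n<0\},\qquad \partial^l_+K=\{x\in\partial K:\omega_l\cdot n\ge0\}.$$ The space $\boldsymbol W_h$ consists of the families $\boldsymbol v_h=(v^0_h,\dots,v^L_h)$ with $v^l_h|_K\in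 C(K)\cap H^1(K)$ for every $l$ and every $K\in T_h$. On $\partial^l_-K$ write $v^l_+$ for the trace of $v^l_h$ from $K$ and $v^l_-$ for the trace from the element adjacent to $K$, with $v^l_-=0$ on $\partial X$, and $[v^l_h]=v^l_+-v^l_-$. On $\partial^l_+K$ write $v^l_-$ for the trace from $K$. With $(\cdot,\cdot)_K$ and $\langle\cdot,\cdot\rangle_S$ the $L^2$ inner products on $K$ and (for the surface measure) on $S\subset\partial K$, and with $\delta=\bar c\,h$, let $$\begin{aligned}a_h(\boldsymbol u_h,\boldsymbol v_h)={}&\sum_l w_l\sum_{K}\big(\omega_l\cdot\nabla u^l_h+\sigma_tu^l_h,\;v^l_h+\delta\,\omega_l\cdot\nabla v^l_h\big)_K+\sum_l w_l\sum_K\big\langle[u^l_h],v^l_+|\omega_l\cdot n|\big\rangle_{\partial^l_-K}\\&-\sum_l w_l\sum_K\Big(\sigma_s\sum_{i=0}^L w_i\,g(\cdot,\omega_l\cdot\omega_i)\,u^i_h,\;v^l_h+\delta\,\omega_l\cdot\nabla v^l_h\Big)_K,\end{aligned}$$ $$\begin{aligned}|||\boldsymbol v_h|||^2={}&\sum_l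 w_l\sum_K c_0'\|v^l_h\|^2_{0,K}+\sum_l w_l\sum_K\big\langle v^l_-,v^l_-\,\omega_l\cdot n\big\rangle_{\partial^l_+K\cap\partial X}\\&+\delta\sum_l w_l\sum_K\|\omega_l\cdot\nabla v^l_h\|^2_{0,K}+\sum_l w_l\sum_K\big\langle[v^l_h],[v^l_h]\,|\omega_l\cdot n|\big\rangle_{\partial^l_-K}.\end{aligned}$$ Then there is $h_0>0$, independent of the partition, such that for all $0<h\le h_0$ and every partition $T_h$ of $X$ with $\operatorname{diam}K\le h$ for all $K\in T_h$, $$|||\boldsymbol v_h|||^2\le 3\,a_h(\boldsymbol v_h,\boldsymbol v_h)\qquad\text{for all }\boldsymbol v_h\in\boldsymbol W_h .$$ -/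

import Mathlib

open MeasureTheory

noncomputable section

namespace DODSD

/-- The physical space `ℝᵈ` with its Euclidean norm and inner product. -/
abbrev Space (d : ℕ) := EuclideanSpace ℝ (Fin d)

/-! ### Sobolev functions -/

/-- `G` is the weak (distributional) gradient of `v` on the open set `U`. -/
def IsWeakGradient {d : ℕ} (U : Set (Space d)) (v : Space d → ℝ) (G : Space d → Space d) : Prop :=
  ∀ φ : Space d → ℝ, ContDiff ℝ (⊤ : ℕ∞) φ → HasCompactSupport φ → tsupport φ ⊆ U →
    ∀ e : Space d,
      ∫ x in U, v x * fderiv ℝ φ x e = -∫ x in U, inner ℝ (G x) e * φ x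

/-- `v` has a weak gradient in `L²(U)`. -/
def HasL2WeakGradient {d : ℕ} (U : Set (Space d)) (v : Space d → ℝ) : Prop :=
  ∃ G : Space d → Space d, IsWeakGradient U v G ∧ MemLp G 2 (volume.restrict U)

/-- `v ∈ H¹(U)`. -/
def MemH1 {d : ℕ} (U : Set (Space d)) (v : Space d → ℝ) : Prop :=
  MemLp v 2 (volume.restrict U) ∧ HasL2WeakGradient U v

open Classical in
/-- The weak gradient of `v ∈ H¹(U)`; it is determined up to a null subset of `U`. -/
def weakGrad {d : ℕ} (U : Set (Space d)) (v : Space d → ℝ) : Space d → Space d :=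
  if h : HasL2WeakGradient U v then h.choose else 0

/-! ### Elements and partitions -/

/-- A convex polytope with nonempty interior: a bounded finite intersection of closed
half-spaces `{x | ⟪a, x⟫ ≤ b}`. -/
def IsConvexPolytope {d : ℕ} (K : Set (Space d)) : Prop :=
  (∃ s : Finset (Space d × ℝ), K = {x | ∀ p ∈ s, inner ℝ p.1 x ≤ p.2}) ∧
    Bornology.IsBounded K ∧ (interior K).Nonempty

/-- A finite element partition of `X`: finitely many convex polytopes with pairwise disjoint
interiors whose union is the closure of `X`. -/
structure MeshPartition {d : ℕ} (X : Set (Space d)) where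
  /-- number of elements -/
  numElems : ℕ
  /-- the (closed) elements `K` -/
  elem : Fin numElems → Set (Space d)
  isConvexPolytope : ∀ j, IsConvexPolytope (elem j)
  disjoint_interior : Pairwise fun i j => Disjoint (interior (elem i)) (interior (elem j))
  iUnion_elem : ⋃ j, elem j = closure X

/-- `n` is a unit outward normal of the convex set `K` at `x`. -/
def IsOutwardNormal {d : ℕ} (K : Set (Space d)) (x n : Space d) : Prop :=
  ‖n‖ = 1 ∧ ∀ y ∈ K, inner ℝ n (y - x) ≤ 0

open Classical in
/-- The unit outward normal `n_K(x)` at a point of the boundary of a convex polytope `K`.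
On the lower-dimensional set where the unit outward normal is not unique
(vertices, and edges when `d = 3`), it is set to `0`. -/
def outwardNormal {d : ℕ} (K : Set (Space d)) (x : Space d) : Space d :=
  if h : ∃! n, IsOutwardNormal K x n then h.choose else 0

/-- The incoming boundary `∂₋K = {x ∈ ∂K : ω · n_K(x) < 0}` for the direction `ω`. -/
def inflow {d : ℕ} (ω : Space d) (K : Set (Space d)) : Set (Space d) :=
  {x | x ∈ frontier K ∧ inner ℝ ω (outwardNormal K x) < 0}

/-- The outgoing boundary `∂₊K = {x ∈ ∂K : ω · n_K(x) ≥ 0}` for the direction `ω`. -/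
def outflow {d : ℕ} (ω : Space d) (K : Set (Space d)) : Set (Space d) :=
  {x | x ∈ frontier K ∧ 0 ≤ inner ℝ ω (outwardNormal K x)}

/-! ### Angular quadrature -/

/-- A quadrature rule on the unit sphere with nodes `ω₀, …, ω_L` and positive weights. -/
structure Quadrature (d L : ℕ) where
  dir : Fin (L + 1) → Space d
  weight : Fin (L + 1) → ℝ
  norm_dir : ∀ l, ‖dir l‖ = 1
  weight_pos : ∀ l, 0 < weight l

/-- `m(x) = max_l ∑ᵢ wᵢ g(x, ω_l · ωᵢ)`. -/
def scatterMax {d L : ℕ} (Q : Quadrature d L) (g : Space d → ℝ → ℝ) (x : Space d) : ℝ :=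
  Finset.univ.sup' Finset.univ_nonempty fun l : Fin (L + 1) =>
    ∑ i, Q.weight i * g x (inner ℝ (Q.dir l) (Q.dir i))

/-! ### The broken space -/

/-- A function on a partition, given by its restriction to each closed element; on the common
boundary of two elements it may have two different values. -/
abbrev BrokenFun {d : ℕ} {X : Set (Space d)} (T : MeshPartition X) :=
  Fin T.numElems → Space d → ℝ

variable {d L : ℕ} {X : Set (Space d)}

/-- Membership in `W_h`: the restriction to every element `K` is in `C(K) ∩ H¹(K)`. -/
def MemBroken (T : MeshPartition X) (w : BrokenFun T) : Prop :=
  ∀ j, ContinuousOn (w j) (T.elem j) ∧ MemH1 (interior (T.elem j)) (w j)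

/-- The directional derivative `ω · ∇w` on the element with index `j`. -/
def dirDeriv (T : MeshPartition X) (ω : Space d) (w : BrokenFun T) (j : Fin T.numElems)
    (x : Space d) : ℝ :=
  inner ℝ ω (weakGrad (interior (T.elem j)) (w j) x)

/-- The trace `w₋` of `w` on the incoming boundary of the element `K` with index `j`: the value of
`w` in the element adjacent to `K` at `x`, and `0` on the boundary of `X`. (Almost every `x` in
`∂K ∩ X` lies in exactly one other element, so the sum has one term.) -/
def upwindTrace (T : MeshPartition X) (w : BrokenFun T) (j : Fin T.numElems) (x : Space d) : ℝ :=
  open Classical in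
  if x ∈ frontier X then 0
  else ∑ i ∈ Finset.univ.erase j, (T.elem i).indicator (w i) x

/-- The jump `[w] = w₊ - w₋` on the incoming boundary of the element with index `j`; there
`w₊` is the value of `w` in that element. -/
def jump (T : MeshPartition X) (w : BrokenFun T) (j : Fin T.numElems) (x : Space d) : ℝ :=
  w j x - upwindTrace T w j x

/-! ### The bilinear form and the norm -/

/-- The bilinear form
`a_h(u, v) = ∑_l w_l ∑_K (ω_l·∇uˡ + σ_t uˡ, vˡ + δ ω_l·∇vˡ)_K
  + ∑_l w_l ∑_K ⟨[uˡ], vˡ₊ |ω_l·n|⟩_{∂₋K}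
  - ∑_l w_l ∑_K (σ_s ∑ᵢ wᵢ g(·, ω_l·ωᵢ) uⁱ, vˡ + δ ω_l·∇vˡ)_K`.
Surface integrals are with respect to the `(d-1)`-dimensional Euclidean surface measure. -/
def bilinForm (Q : Quadrature d L) (σt σs : Space d → ℝ) (g : Space d → ℝ → ℝ) (δ : ℝ)
    (T : MeshPartition X) (u v : Fin (L + 1) → BrokenFun T) : ℝ :=
  (∑ l, Q.weight l * ∑ j, ∫ x in T.elem j,
      (dirDeriv T (Q.dir l) (u l) j x + σt x * u l j x) *
        (v l j x + δ * dirDeriv T (Q.dir l) (v l) j x))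
  + (∑ l, Q.weight l * ∑ j, ∫ x in inflow (Q.dir l) (T.elem j),
      jump T (u l) j x * (v l j x * |inner ℝ (Q.dir l) (outwardNormal (T.elem j) x)|) ∂μHE[d - 1])
  - (∑ l, Q.weight l * ∑ j, ∫ x in T.elem j,
      (σs x * ∑ i, Q.weight i * g x (inner ℝ (Q.dir l) (Q.dir i)) * u i j x) *
        (v l j x + δ * dirDeriv T (Q.dir l) (v l) j x))

/-- The square of the norm,
`|||v|||² = ∑_l w_l ∑_K c ‖vˡ‖²_K + ∑_l w_l ∑_K ⟨vˡ₋, vˡ₋ ω_l·n⟩_{∂₊K ∩ ∂X}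
  + δ ∑_l w_l ∑_K ‖ω_l·∇vˡ‖²_K + ∑_l w_l ∑_K ⟨[vˡ], [vˡ] |ω_l·n|⟩_{∂₋K}`.
On the outgoing boundary of `K` the trace `v₋` is the value of `v` in `K`. -/
def tripleNormSq (Q : Quadrature d L) (c δ : ℝ)
    (T : MeshPartition X) (v : Fin (L + 1) → BrokenFun T) : ℝ :=
  (∑ l, Q.weight l * ∑ j, c * ∫ x in T.elem j, v l j x ^ 2)
  + (∑ l, Q.weight l * ∑ j, ∫ x in outflow (Q.dir l) (T.elem j) ∩ frontier X,
      v l j x * (v l j x * inner ℝ (Q.dir l) (outwardNormal (T.elem j) x)) ∂μHE[d - 1])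
  + δ * (∑ l, Q.weight l * ∑ j, ∫ x in T.elem j, dirDeriv T (Q.dir l) (v l) j x ^ 2)
  + (∑ l, Q.weight l * ∑ j, ∫ x in inflow (Q.dir l) (T.elem j),
      jump T (v l) j x *
        (jump T (v l) j x * |inner ℝ (Q.dir l) (outwardNormal (T.elem j) x)|) ∂μHE[d - 1])

end DODSD

end

/-!
The jump terms and the volume terms `(ω · ∇v, v)_K` of the bilinear form combine to half of the
boundary terms of the norm; everything else is a pointwise inequality.

*Boundary terms.* On each element `2 (ω · ∇v, v)_K = ∫_{∂K} v² ω · n`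
(`IsUnitRep.integral_mul_weakGradient`). For a smooth function this is Fubini's theorem along the
lines in the direction `ω` (`IsUnitRep.integral_fderiv_eq`): almost every such line that meets `K`
crosses `∂K` in two facets, transversally, and the surface measure of a facet with normal `n` is the measure of its
shadow on `ωᗮ` divided by `|n · ω|` (`surfaceMeasure_eq_shadow`). For `v ∈ C(K) ∩ H¹(K)` one
mollifies `v`, evaluates the result on `K` contracted towards an interior point, and moves the
mollifier off the weak gradient by Fubini's theorem, so that dominated convergence applies on both
sides. In the sum over the elements the interface contributions cancel: outside a set of surface
measure zero, an interface point belongs to exactly two elements, with opposite normals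
(`MeshPartition.exists_neighbour`). What remains are the squared jumps and the outgoing values on
`∂X`, each with the factor one half (`MeshPartition.upwind_identity`).

*Volume terms.* By the symmetry of `g(x, ω_l · ω_i)` in `l, i`, the scattering operator is bounded
by `m σ_s` in the weighted `ℓ²` norm (`scattering_le`), so the terms without `δ` are at least
`(σ_t - m σ_s) ∑ w_l (vˡ)² ≥ c ∑ w_l (vˡ)²`. Since `m σ_s ≤ σ_t ≤ M`, the cross terms with the
factor `δ` are absorbed at the cost of `δ/2 ∑ w_l (ω_l · ∇vˡ)²` and `2 δ M² ∑ w_l (vˡ)²`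
(`coercivity_pointwise`). Hence `h₀ = c / (3 cbar M²)` works; it depends on the coefficients only.
-/

noncomputable section

namespace DODSD

/-! ### Surface measure on hyperplanes -/

section Graph

variable {V : Type*} [NormedAddCommGroup V] [InnerProductSpace ℝ V]

/-- The point of the hyperplane `{x | ⟪n, x⟫ = b}` on the line through `y ∈ ωᗮ` in the
direction `ω` (meaningful when `⟪n, ω⟫ ≠ 0`). -/
def graphMap (ω n : V) (b : ℝ) (y : (Submodule.span ℝ {ω})ᗮ) : V :=
  (y : V) + ((b - inner ℝ n (y : V)) / inner ℝ n ω) • ω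

/-- The linear part of `graphMap`. -/
def graphLinear (ω n : V) : (Submodule.span ℝ {ω})ᗮ →ₗ[ℝ] V where
  toFun y := (y : V) - (inner ℝ n (y : V) / inner ℝ n ω) • ω
  map_add' x y := by
    simp only [Submodule.coe_add, inner_add_right, add_div, add_smul]; abel
  map_smul' c y := by
    simp only [Submodule.coe_smul, inner_smul_right, RingHom.id_apply, smul_sub, smul_smul,
      mul_div_assoc]

lemma graphMap_eq (ω n : V) (b : ℝ) (y : (Submodule.span ℝ {ω})ᗮ) :
    graphMap ω n b y = (b / inner ℝ n ω) • ω + graphLinear ω n y := by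
  simp only [graphMap, graphLinear, LinearMap.coe_mk, AddHom.coe_mk, sub_div, sub_smul]; abel

lemma inner_dir_coe {ω : V} (y : (Submodule.span ℝ {ω})ᗮ) : inner ℝ ω (y : V) = 0 :=
  Submodule.mem_orthogonal_singleton_iff_inner_right.1 y.2

/-- A point `y + t ω` lies on the hyperplane exactly when it is the value of `graphMap`. -/
lemma add_smul_eq_graphMap {ω n : V} (h : inner ℝ n ω ≠ 0) {b t : ℝ}
    {y : (Submodule.span ℝ {ω})ᗮ} (ht : inner ℝ n ((y : V) + t • ω) = b) :
    (y : V) + t • ω = graphMap ω n b y := by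
  rw [inner_add_right, inner_smul_right] at ht
  rw [graphMap, ← ht]
  congr 2
  field_simp; ring

variable [FiniteDimensional ℝ V]

lemma measurableEmbedding_graphMap [MeasurableSpace V] [BorelSpace V] (ω n : V) (b : ℝ) :
    MeasurableEmbedding (graphMap ω n b) := by
  have hc : Continuous (graphMap ω n b) := by unfold graphMap; fun_prop
  refine hc.measurableEmbedding ?_
  intro y z hyz
  have h1 : ((y - z : (Submodule.span ℝ {ω})ᗮ) : V) =
      ((b - inner ℝ n (z : V)) / inner ℝ n ω - (b - inner ℝ n (y : V)) / inner ℝ n ω) • ω := by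
    rw [sub_smul, Submodule.coe_sub, sub_eq_sub_iff_add_eq_add, add_comm _ (z : V)]
    exact hyz
  have h2 : inner ℝ ((y - z : (Submodule.span ℝ {ω})ᗮ) : V)
      ((y - z : (Submodule.span ℝ {ω})ᗮ) : V) = 0 := by
    nth_rewrite 1 [h1]
    rw [real_inner_smul_left, inner_dir_coe, mul_zero]
  exact sub_eq_zero.1 (Subtype.ext (inner_self_eq_zero.1 h2))

/-- The Gram matrix of `graphLinear` is `1 + c cᵀ` with `cᵢ = ⟪n, bᵢ⟫ / ⟪n, ω⟫`, whose determinant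
is `1 + ‖c‖² = ⟪n, ω⟫⁻²`. -/
lemma normDet_graphLinear {ω n : V} (hω : ‖ω‖ = 1) (hn : ‖n‖ = 1) (h : inner ℝ n ω ≠ 0) :
    (graphLinear ω n).normDet = |inner ℝ n ω|⁻¹ := by
  set W := (Submodule.span ℝ {ω})ᗮ with hW
  let b := stdOrthonormalBasis ℝ W
  have hωω : inner ℝ ω ω = (1 : ℝ) := by rw [real_inner_self_eq_norm_sq, hω]; norm_num
  have hsq : (graphLinear ω n).normDet ^ 2 = (|inner ℝ n ω|⁻¹) ^ 2 := by
    have hg := LinearMap.normDet_sq_eq_det_gram (graphLinear ω n) b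
    simp only [RCLike.ofReal_real_eq_id, id] at hg
    rw [hg]
    set c : Fin (Module.finrank ℝ W) → ℝ := fun i => inner ℝ n (b i : V) / inner ℝ n ω with hc
    have hm : (Matrix.gram ℝ fun i => graphLinear ω n (b i)) =
        1 + Matrix.replicateCol (Fin 1) c * Matrix.replicateRow (Fin 1) c := by
      ext i j
      have hij : inner ℝ (b i : V) (b j : V) = if i = j then (1 : ℝ) else 0 := by
        rw [← Submodule.coe_inner]; exact orthonormal_iff_ite.1 b.orthonormal i j
      have e1 : inner ℝ ω (b j : V) = (0 : ℝ) := inner_dir_coe (b j)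
      have e2 : inner ℝ (b i : V) ω = (0 : ℝ) := by
        rw [real_inner_comm]; exact inner_dir_coe (b i)
      simp only [Matrix.gram_apply, graphLinear, LinearMap.coe_mk, AddHom.coe_mk, inner_sub_left,
        inner_sub_right, real_inner_smul_left, inner_smul_right, hij, e1, e2, hωω,
        Matrix.add_apply, Matrix.one_apply, Matrix.mul_apply, Matrix.replicateCol_apply,
        Matrix.replicateRow_apply, Finset.univ_unique, Finset.sum_const, Finset.card_singleton, hc]
      simp
      ring
    rw [hm]
    refine (Matrix.det_one_add_replicateCol_mul_replicateRow c c).trans ?_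
    have hnorm : ∑ i, inner ℝ n (b i : V) ^ 2 = 1 - inner ℝ n ω ^ 2 := by
      have h1 := Submodule.norm_sq_eq_add_norm_sq_projection n (Submodule.span ℝ {ω})
      rw [hn] at h1
      have h2 : ‖(Submodule.span ℝ {ω}).orthogonalProjectionOnto n‖ ^ 2 = inner ℝ n ω ^ 2 := by
        change ‖((Submodule.span ℝ {ω}).orthogonalProjectionOnto n : V)‖ ^ 2 = _
        rw [Submodule.coe_orthogonalProjectionOnto_apply,
          Submodule.starProjection_unit_singleton ℝ hω, norm_smul, hω, mul_one,
          Real.norm_eq_abs, sq_abs, real_inner_comm]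
      have h3 := b.sum_sq_inner_right (W.orthogonalProjectionOnto n)
      have h4 : ∀ i, inner ℝ (b i) (W.orthogonalProjectionOnto n) = inner ℝ n (b i : V) := by
        intro i
        rw [real_inner_comm, Submodule.inner_orthogonalProjectionOnto_eq_of_mem_right]
      simp only [h4] at h3
      rw [h3]; linarith
    have : c ⬝ᵥ c = (∑ i, inner ℝ n (b i : V) ^ 2) / inner ℝ n ω ^ 2 := by
      simp only [dotProduct, hc, Finset.sum_div]
      exact Finset.sum_congr rfl fun i _ => by ring
    rw [this, hnorm, inv_pow, sq_abs]
    field_simp; ring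
  exact (sq_eq_sq₀ (LinearMap.normDet_nonneg _) (by positivity)).1 hsq

variable [MeasurableSpace V] [BorelSpace V]

omit [FiniteDimensional ℝ V] [MeasurableSpace V] [BorelSpace V] in
lemma finrank_orthogonal_span {m : ℕ} (hV : Module.finrank ℝ V = m + 1) {ω : V} (hω : ‖ω‖ = 1) :
    Module.finrank ℝ (Submodule.span ℝ {ω})ᗮ = m := by
  have : Fact (Module.finrank ℝ V = m + 1) := ⟨hV⟩
  exact Submodule.finrank_orthogonal_span_singleton (by rintro rfl; simp at hω)

/-- Surface measure on a hyperplane, as the measure of the shadow in the direction `ω` divided by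
the cosine of the angle between the normal and `ω`. -/
lemma surfaceMeasure_eq_shadow {m : ℕ} (hV : Module.finrank ℝ V = m + 1) {ω n : V} (hω : ‖ω‖ = 1)
    (hn : ‖n‖ = 1) (h : inner ℝ n ω ≠ 0) {b : ℝ} {S : Set V} (hS : S ⊆ {x | inner ℝ n x = b}) :
    (μHE[m] : Measure V) S = ENNReal.ofReal |inner ℝ n ω|⁻¹ * volume (graphMap ω n b ⁻¹' S) := by
  have himg : S = graphMap ω n b '' (graphMap ω n b ⁻¹' S) := by
    rw [Set.image_preimage_eq_iff.2]
    intro x hx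
    refine ⟨(Submodule.span ℝ {ω})ᗮ.orthogonalProjectionOnto x, ?_⟩
    have hx' : x = ((Submodule.span ℝ {ω})ᗮ.orthogonalProjectionOnto x : V) +
        inner ℝ ω x • ω := by
      have := Submodule.starProjection_add_starProjection_orthogonal (K := Submodule.span ℝ {ω}) x
      rw [Submodule.starProjection_unit_singleton ℝ hω] at this
      rw [Submodule.coe_orthogonalProjectionOnto_apply, add_comm]; exact this.symm
    conv_rhs => rw [hx']
    refine (add_smul_eq_graphMap h ?_).symm
    rw [← hx']; exact hS hx
  set A := graphMap ω n b ⁻¹' S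
  have h2 : graphMap ω n b '' A =
      (fun x => ((b / inner ℝ n ω) • ω) +ᵥ x) '' (graphLinear ω n '' A) := by
    rw [Set.image_image]
    exact Set.image_congr fun y _ => graphMap_eq ω n b y
  rw [himg, h2, (isometry_vadd V ((b / inner ℝ n ω) • ω)).euclideanHausdorffMeasure_image]
  have := LinearMap.euclideanHausdorffMeasure_image_eq_normDet_mul_volume (graphLinear ω n) A
  rwa [finrank_orthogonal_span hV hω, normDet_graphLinear hω hn h] at this

lemma surfaceMeasure_restrict_eq_map {m : ℕ} (hV : Module.finrank ℝ V = m + 1) {ω n : V}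
    (hω : ‖ω‖ = 1) (hn : ‖n‖ = 1) (h : inner ℝ n ω ≠ 0) {b : ℝ} {S : Set V}
    (hS : S ⊆ {x | inner ℝ n x = b}) :
    (μHE[m] : Measure V).restrict S = ENNReal.ofReal |inner ℝ n ω|⁻¹ •
      (volume.restrict (graphMap ω n b ⁻¹' S)).map (graphMap ω n b) := by
  have hg := measurableEmbedding_graphMap ω n b
  ext A hA
  rw [Measure.restrict_apply hA, Measure.smul_apply, hg.map_apply,
    Measure.restrict_apply (hg.measurable hA), smul_eq_mul,
    surfaceMeasure_eq_shadow hV hω hn h (Set.inter_subset_right.trans hS), Set.preimage_inter]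

lemma setIntegral_surfaceMeasure {m : ℕ} (hV : Module.finrank ℝ V = m + 1) {ω n : V}
    (hω : ‖ω‖ = 1) (hn : ‖n‖ = 1) (h : inner ℝ n ω ≠ 0) {b : ℝ} {S : Set V}
    (hS : S ⊆ {x | inner ℝ n x = b}) (f : V → ℝ) :
    ∫ x in S, f x ∂μHE[m] =
      |inner ℝ n ω|⁻¹ * ∫ y in graphMap ω n b ⁻¹' S, f (graphMap ω n b y) := by
  rw [surfaceMeasure_restrict_eq_map hV hω hn h hS, integral_smul_measure,
    (measurableEmbedding_graphMap ω n b).integral_map, smul_eq_mul,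
    ENNReal.toReal_ofReal (by positivity)]

/-- Lebesgue measure in the coordinates given by a unit vector `ω` and its orthogonal
complement. -/
lemma measurePreserving_add_smul {ω : V} (hω : ‖ω‖ = 1) :
    MeasurePreserving (fun p : (Submodule.span ℝ {ω})ᗮ × ℝ => (p.1 : V) + p.2 • ω)
      (volume.prod volume) volume := by
  have h1 := ((Submodule.span ℝ {ω}).measurePreserving_measurableEquivProd (0 : V)).symm
  rw [InnerProductSpace.euclideanHausdorffMeasure_eq_volume, Measure.volume_eq_prod] at h1
  have h2 := (LinearIsometryEquiv.toSpanUnitSingleton ω hω).measurePreserving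
  have h3 : MeasurePreserving (fun p : (Submodule.span ℝ {ω})ᗮ × ℝ => (p.2, p.1))
      (volume.prod volume) (volume.prod volume) := Measure.measurePreserving_swap
  have h4 := h2.prod (MeasurePreserving.id (volume : Measure (Submodule.span ℝ {ω})ᗮ))
  have h5 : (fun p : (Submodule.span ℝ {ω})ᗮ × ℝ => (p.1 : V) + p.2 • ω) =
      ((Submodule.span ℝ {ω}).measurableEquivProd (0 : V)).symm ∘
        (Prod.map (LinearIsometryEquiv.toSpanUnitSingleton ω hω) id ∘ fun p => (p.2, p.1)) := by
    funext p
    have := Submodule.measurableEquivProd_symm_apply (Submodule.span ℝ {ω}) (0 : V)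
      (LinearIsometryEquiv.toSpanUnitSingleton ω hω p.2, p.1)
    refine Eq.trans ?_ this.symm
    simp [add_comm]
  rw [h5]
  exact h1.comp (h4.comp h3)

lemma measurableEmbedding_add_smul {ω : V} (hω : ‖ω‖ = 1) :
    MeasurableEmbedding (fun p : (Submodule.span ℝ {ω})ᗮ × ℝ => (p.1 : V) + p.2 • ω) := by
  have hc : Continuous (fun p : (Submodule.span ℝ {ω})ᗮ × ℝ => (p.1 : V) + p.2 • ω) := by fun_prop
  refine hc.measurableEmbedding ?_
  rintro ⟨y, s⟩ ⟨z, t⟩ hyz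
  have hyz : (y : V) + s • ω = (z : V) + t • ω := hyz
  have hωω : inner ℝ ω ω = (1 : ℝ) := by rw [real_inner_self_eq_norm_sq, hω]; norm_num
  have hst : s = t := by
    have := congrArg (inner ℝ ω) hyz
    simpa only [inner_add_right, inner_smul_right, inner_dir_coe, hωω, mul_one, zero_add]
      using this
  subst hst
  simpa using hyz

/-- A level set of a nonzero linear functional is a null set. -/
lemma volume_inner_eq_zero {z : V} (hz : z ≠ 0) (c : ℝ) :
    volume {y : V | inner ℝ z y = c} = 0 := by
  have hzz : inner ℝ z z ≠ (0 : ℝ) := inner_self_ne_zero.2 hz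
  have hset : {y : V | inner ℝ z y = c} =
      (AffineSubspace.mk' ((c / inner ℝ z z) • z) (Submodule.span ℝ {z})ᗮ : Set V) := by
    ext y
    rw [SetLike.mem_coe, AffineSubspace.mem_mk', vsub_eq_sub,
      Submodule.mem_orthogonal_singleton_iff_inner_right, inner_sub_right, inner_smul_right,
      div_mul_cancel₀ _ hzz, sub_eq_zero, Set.mem_ofPred_eq]
  rw [hset]
  refine Measure.addHaar_affineSubspace _ _ ?_
  intro htop
  have h2 : (Submodule.span ℝ {z})ᗮ = ⊤ := by
    have := congrArg AffineSubspace.direction htop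
    simpa using this
  have : z ∈ (Submodule.span ℝ {z})ᗮ := by rw [h2]; trivial
  exact hzz (Submodule.mem_orthogonal_singleton_iff_inner_right.1 this)

lemma volume_shadow_inner_eq_zero {ω z : V} (hz : z ∉ Submodule.span ℝ {ω}) (c : ℝ) :
    volume {y : (Submodule.span ℝ {ω})ᗮ | inner ℝ z (y : V) = c} = 0 := by
  have h0 : (Submodule.span ℝ {ω})ᗮ.orthogonalProjectionOnto z ≠ 0 := by
    rw [Ne, Submodule.orthogonalProjectionOnto_eq_zero_iff, Submodule.orthogonal_orthogonal]
    exact hz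
  convert volume_inner_eq_zero h0 c using 4 with y
  rw [Submodule.inner_orthogonalProjectionOnto_eq_of_mem_right]

omit [FiniteDimensional ℝ V] [MeasurableSpace V] [BorelSpace V] in
lemma eq_or_eq_neg_of_mem_span {p q : V} (hp : ‖p‖ = 1) (hq : ‖q‖ = 1)
    (h : q ∈ Submodule.span ℝ {p}) : q = p ∨ q = -p := by
  obtain ⟨c, rfl⟩ := Submodule.mem_span_singleton.1 h
  rw [norm_smul, hp, mul_one, Real.norm_eq_abs] at hq
  rcases (abs_eq zero_le_one).1 hq with rfl | rfl
  · left; simp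
  · right; simp

/-- The intersection of two non-parallel hyperplanes has surface measure zero. -/
lemma surfaceMeasure_inter_hyperplanes {m : ℕ} (hV : Module.finrank ℝ V = m + 1) {p q : V}
    (hp : ‖p‖ = 1) (hq : ‖q‖ = 1) (h1 : q ≠ p) (h2 : q ≠ -p) (b c : ℝ) :
    (μHE[m] : Measure V) ({x | inner ℝ p x = b} ∩ {x | inner ℝ q x = c}) = 0 := by
  have hpp : inner ℝ p p = (1 : ℝ) := by rw [real_inner_self_eq_norm_sq, hp]; norm_num
  rw [surfaceMeasure_eq_shadow hV hp hp (by rw [hpp]; norm_num) Set.inter_subset_left]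
  have hz : q ∉ Submodule.span ℝ {p} := fun h => by
    rcases eq_or_eq_neg_of_mem_span hp hq h with h | h
    exacts [h1 h, h2 h]
  refine mul_eq_zero_of_right _ (measure_mono_null ?_
    (volume_shadow_inner_eq_zero hz (c - b * inner ℝ q p)))
  rintro y ⟨-, hy⟩
  simp only [Set.mem_ofPred_eq, graphMap, hpp, inner_dir_coe, inner_add_right,
    inner_smul_right] at hy ⊢
  linarith

/-- A bounded part of a hyperplane has finite surface measure. -/
lemma surfaceMeasure_lt_top {m : ℕ} (hV : Module.finrank ℝ V = m + 1) {p : V} (hp : ‖p‖ = 1)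
    (b : ℝ) {S : Set V} (hS : S ⊆ {x | inner ℝ p x = b}) (hb : Bornology.IsBounded S) :
    (μHE[m] : Measure V) S < ⊤ := by
  have hpp : inner ℝ p p = (1 : ℝ) := by rw [real_inner_self_eq_norm_sq, hp]; norm_num
  rw [surfaceMeasure_eq_shadow hV hp hp (by rw [hpp]; norm_num) hS]
  obtain ⟨R, hR⟩ := hb.exists_norm_le
  refine ENNReal.mul_lt_top ENNReal.ofReal_lt_top (Bornology.IsBounded.measure_lt_top ?_)
  refine (isBounded_iff_forall_norm_le).2 ⟨R + |b|, fun y hy => ?_⟩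
  have h1 := hR _ hy
  have h2 : (y : V) = graphMap p p b y - b • p := by
    rw [graphMap, hpp, inner_dir_coe, sub_zero, div_one, add_sub_cancel_right]
  change ‖(y : V)‖ ≤ _
  rw [h2]
  refine (norm_sub_le _ _).trans ?_
  rw [norm_smul, hp, mul_one, Real.norm_eq_abs]
  gcongr

end Graph

/-! ### Convex polytopes and their outward normals -/

section Polytope

open Filter Topology

variable {d : ℕ}

/-- `K` is a bounded set with nonempty interior, cut out by the half-spaces
`{x | ⟪p.1, x⟫ ≤ p.2}` with unit normals `p.1`, where `p` runs through the finite set `N`. -/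
structure IsUnitRep (N : Finset (Space d × ℝ)) (K : Set (Space d)) : Prop where
  unit : ∀ p ∈ N, ‖p.1‖ = 1
  mem_iff : ∀ x, x ∈ K ↔ ∀ p ∈ N, inner ℝ p.1 x ≤ p.2
  bounded : Bornology.IsBounded K
  nonempty : (interior K).Nonempty

lemma IsConvexPolytope.exists_isUnitRep {K : Set (Space d)} (hK : IsConvexPolytope K) :
    ∃ N, IsUnitRep N K := by
  classical
  obtain ⟨⟨s, hs⟩, hb, hne⟩ := hK
  have hmem : ∀ x, x ∈ K ↔ ∀ p ∈ s, inner ℝ p.1 x ≤ p.2 := fun x => by rw [hs]; rfl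
  refine ⟨(s.filter fun p => p.1 ≠ 0).image fun p => (‖p.1‖⁻¹ • p.1, ‖p.1‖⁻¹ * p.2),
    ?_, fun x => ?_, hb, hne⟩
  · intro p hp
    simp only [Finset.mem_image, Finset.mem_filter] at hp
    obtain ⟨q, ⟨-, hq0⟩, rfl⟩ := hp
    simp [norm_smul, inv_mul_cancel₀ (norm_ne_zero_iff.2 hq0)]
  · rw [hmem]
    simp only [Finset.mem_image, Finset.mem_filter, forall_exists_index, and_imp]
    constructor
    · rintro h _ q hq hq0 rfl
      rw [real_inner_smul_left]
      exact mul_le_mul_of_nonneg_left (h q hq) (by positivity)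
    · intro h p hp
      by_cases hp0 : p.1 = 0
      · obtain ⟨z, hz⟩ := hne
        have := (hmem z).1 (interior_subset hz) p hp
        simpa [hp0] using this
      · have := h _ p hp hp0 rfl
        rw [real_inner_smul_left] at this
        exact le_of_mul_le_mul_left this (inv_pos.2 (norm_pos_iff.2 hp0))

/-- The relative interior of the face of `K` with outward normal `p.1`: at its points no constraint
with a different normal is active. -/
def facet (N : Finset (Space d × ℝ)) (K : Set (Space d)) (p : Space d × ℝ) : Set (Space d) :=
  {x | x ∈ K ∧ inner ℝ p.1 x = p.2 ∧ ∀ q ∈ N, q.1 ≠ p.1 → inner ℝ q.1 x < q.2}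

namespace IsUnitRep

variable {N : Finset (Space d × ℝ)} {K : Set (Space d)}

lemma isClosed (h : IsUnitRep N K) : IsClosed K := by
  have : K = ⋂ p ∈ N, {x | inner ℝ p.1 x ≤ p.2} := by
    ext x; simp [h.mem_iff]
  rw [this]
  exact isClosed_biInter fun p _ => isClosed_le (by fun_prop) continuous_const

lemma isCompact (h : IsUnitRep N K) : IsCompact K :=
  Metric.isCompact_of_isClosed_isBounded h.isClosed h.bounded

lemma convex (h : IsUnitRep N K) : Convex ℝ K := by
  have : K = ⋂ p ∈ N, {x | inner ℝ p.1 x ≤ p.2} := by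
    ext x; simp [h.mem_iff]
  rw [this]
  exact convex_iInter₂ fun p _ => convex_halfSpace_le (innerₗ (Space d) p.1).isLinear _

lemma inner_self_eq_one (h : IsUnitRep N K) {p : Space d × ℝ} (hp : p ∈ N) :
    inner ℝ p.1 p.1 = (1 : ℝ) := by
  rw [real_inner_self_eq_norm_sq, h.unit p hp]; norm_num

lemma mem_interior_iff (h : IsUnitRep N K) {x : Space d} :
    x ∈ interior K ↔ ∀ p ∈ N, inner ℝ p.1 x < p.2 := by
  constructor
  · intro hx p hp
    have hcont : Tendsto (fun ε : ℝ => x + ε • p.1) (𝓝[>] 0) (𝓝 x) := by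
      have : Continuous fun ε : ℝ => x + ε • p.1 := by fun_prop
      simpa using (this.tendsto 0).mono_left nhdsWithin_le_nhds
    obtain ⟨ε, hε, hε0⟩ :=
      ((hcont.eventually (mem_interior_iff_mem_nhds.1 hx)).and self_mem_nhdsWithin).exists
    have h1 := (h.mem_iff _).1 hε p hp
    rw [inner_add_right, inner_smul_right, h.inner_self_eq_one hp] at h1
    have : (0 : ℝ) < ε := hε0
    linarith
  · intro hx
    have ho : IsOpen {y : Space d | ∀ p ∈ N, inner ℝ p.1 y < p.2} := by
      have : {y : Space d | ∀ p ∈ N, inner ℝ p.1 y < p.2} =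
          ⋂ p ∈ N, {y | inner ℝ p.1 y < p.2} := by ext; simp
      rw [this]
      exact isOpen_biInter_finset fun p _ => isOpen_lt (by fun_prop) continuous_const
    refine interior_maximal ?_ ho hx
    intro y hy
    exact (h.mem_iff y).2 fun p hp => (hy p hp).le

lemma mem_frontier_iff (h : IsUnitRep N K) {x : Space d} :
    x ∈ frontier K ↔ x ∈ K ∧ ∃ p ∈ N, inner ℝ p.1 x = p.2 := by
  rw [h.isClosed.frontier_eq, Set.mem_sdiff, h.mem_interior_iff]
  refine and_congr_right fun hx => ?_
  push Not
  exact exists_congr fun p => and_congr_right fun hp =>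
    ⟨fun h1 => le_antisymm ((h.mem_iff x).1 hx p hp) h1, fun h1 => h1.ge⟩

lemma facet_subset_frontier (h : IsUnitRep N K) {p : Space d × ℝ} (hp : p ∈ N) :
    facet N K p ⊆ frontier K := fun _ hx => h.mem_frontier_iff.2 ⟨hx.1, p, hp, hx.2.1⟩

/-- Two constraints with opposite normals are never active at the same point, since `K` has
nonempty interior. -/
lemma ne_neg_of_active (h : IsUnitRep N K) {p q : Space d × ℝ} (hp : p ∈ N) (hq : q ∈ N)
    {x : Space d} (hpx : inner ℝ p.1 x = p.2) (hqx : inner ℝ q.1 x = q.2) : q.1 ≠ -p.1 := by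
  intro hpq
  obtain ⟨z, hz⟩ := h.nonempty
  have h1 := h.mem_interior_iff.1 hz p hp
  have h2 := h.mem_interior_iff.1 hz q hq
  rw [← hpx] at h1
  rw [← hqx, hpq, inner_neg_left, inner_neg_left] at h2
  linarith

lemma eventually_add_smul_mem (h : IsUnitRep N K) {p : Space d × ℝ} {x e : Space d}
    (hx : x ∈ facet N K p) (he : inner ℝ p.1 e ≤ 0) : ∀ᶠ ε : ℝ in 𝓝[>] 0, x + ε • e ∈ K := by
  have h1 : ∀ q ∈ N, ∀ᶠ ε : ℝ in 𝓝[>] 0, inner ℝ q.1 (x + ε • e) ≤ q.2 := by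
    intro q hq
    by_cases hqp : q.1 = p.1
    · filter_upwards [self_mem_nhdsWithin] with ε hε
      rw [inner_add_right, inner_smul_right]
      have := (h.mem_iff x).1 hx.1 q hq
      have hε : (0 : ℝ) < ε := hε
      rw [hqp] at this ⊢
      nlinarith
    · have hcont : Continuous fun ε : ℝ => inner ℝ q.1 (x + ε • e) := by fun_prop
      have h2 : ∀ᶠ ε in 𝓝 (0 : ℝ), inner ℝ q.1 (x + ε • e) < q.2 :=
        hcont.continuousAt.eventually_lt continuousAt_const (by simpa using hx.2.2 q hq hqp)
      exact (h2.filter_mono nhdsWithin_le_nhds).mono fun _ => le_of_lt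
  filter_upwards [(eventually_all_finset N).2 h1] with ε hε
  exact (h.mem_iff _).2 hε

lemma eventually_sub_smul_mem_interior (h : IsUnitRep N K) {p : Space d × ℝ} {x : Space d}
    (hp : p ∈ N) (hx : x ∈ facet N K p) : ∀ᶠ ε : ℝ in 𝓝[>] 0, x - ε • p.1 ∈ interior K := by
  have h1 : ∀ q ∈ N, ∀ᶠ ε : ℝ in 𝓝[>] 0, inner ℝ q.1 (x - ε • p.1) < q.2 := by
    intro q hq
    by_cases hqp : q.1 = p.1
    · filter_upwards [self_mem_nhdsWithin] with ε hε
      rw [inner_sub_right, inner_smul_right]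
      have := (h.mem_iff x).1 hx.1 q hq
      have hε : (0 : ℝ) < ε := hε
      rw [hqp] at this ⊢
      rw [h.inner_self_eq_one hp]
      linarith
    · have hcont : Continuous fun ε : ℝ => inner ℝ q.1 (x - ε • p.1) := by fun_prop
      have h2 : ∀ᶠ ε in 𝓝 (0 : ℝ), inner ℝ q.1 (x - ε • p.1) < q.2 :=
        hcont.continuousAt.eventually_lt continuousAt_const (by simpa using hx.2.2 q hq hqp)
      exact h2.filter_mono nhdsWithin_le_nhds
  filter_upwards [(eventually_all_finset N).2 h1] with ε hε
  exact h.mem_interior_iff.2 hε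

lemma isOutwardNormal_of_active (h : IsUnitRep N K) {p : Space d × ℝ} (hp : p ∈ N) {x : Space d}
    (hx : inner ℝ p.1 x = p.2) : IsOutwardNormal K x p.1 := by
  refine ⟨h.unit p hp, fun y hy => ?_⟩
  rw [inner_sub_right, hx]
  linarith [(h.mem_iff y).1 hy p hp]

lemma eq_of_isOutwardNormal (h : IsUnitRep N K) {p : Space d × ℝ} (hp : p ∈ N) {x n : Space d}
    (hx : x ∈ facet N K p) (hn : IsOutwardNormal K x n) : n = p.1 := by
  have key : ∀ e : Space d, inner ℝ p.1 e ≤ 0 → inner ℝ n e ≤ 0 := by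
    intro e he
    obtain ⟨ε, hε, hε0⟩ := ((h.eventually_add_smul_mem hx he).and self_mem_nhdsWithin).exists
    have h1 := hn.2 _ hε
    rw [add_sub_cancel_left, inner_smul_right] at h1
    exact nonpos_of_mul_nonpos_right h1 hε0
  have hpp := h.inner_self_eq_one hp
  have hnn : inner ℝ n n = (1 : ℝ) := by rw [real_inner_self_eq_norm_sq, hn.1]; norm_num
  have h1 := key (-p.1) (by rw [inner_neg_right, hpp]; norm_num)
  have h2 := key (n - inner ℝ p.1 n • p.1) (by
    rw [inner_sub_right, inner_smul_right, hpp]; simp)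
  rw [inner_neg_right] at h1
  rw [inner_sub_right, inner_smul_right, hnn, real_inner_comm] at h2
  refine (inner_eq_one_iff_of_norm_eq_one (𝕜 := ℝ) hn.1 (h.unit p hp)).1 ?_
  have h3 : inner ℝ n p.1 ≤ 1 := by
    have := real_inner_le_norm n p.1
    rwa [hn.1, h.unit p hp, one_mul] at this
  nlinarith

lemma outwardNormal_of_mem_facet (h : IsUnitRep N K) {p : Space d × ℝ} (hp : p ∈ N) {x : Space d}
    (hx : x ∈ facet N K p) : outwardNormal K x = p.1 := by
  have hu : ∃! n, IsOutwardNormal K x n :=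
    ⟨p.1, h.isOutwardNormal_of_active hp hx.2.1, fun n hn => h.eq_of_isOutwardNormal hp hx hn⟩
  rw [outwardNormal, dif_pos hu]
  exact h.eq_of_isOutwardNormal hp hx hu.choose_spec.1

lemma mem_facet_or (h : IsUnitRep N K) {x : Space d} (hx : x ∈ frontier K) :
    (∃ p ∈ N, x ∈ facet N K p) ∨
      ∃ p ∈ N, ∃ q ∈ N, inner ℝ p.1 x = p.2 ∧ inner ℝ q.1 x = q.2 ∧ q.1 ≠ p.1 := by
  obtain ⟨hxK, p, hp, hpx⟩ := h.mem_frontier_iff.1 hx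
  by_cases hq : ∃ q ∈ N, q.1 ≠ p.1 ∧ inner ℝ q.1 x = q.2
  · obtain ⟨q, hq, hqp, hqx⟩ := hq
    exact Or.inr ⟨p, hp, q, hq, hpx, hqx, hqp⟩
  · push Not at hq
    exact Or.inl ⟨p, hp, hxK, hpx, fun q hqN hqp =>
      lt_of_le_of_ne ((h.mem_iff x).1 hxK q hqN) (hq q hqN hqp)⟩

/-- Away from the facets the normal is not unique, so that `outwardNormal` takes its default
value. -/
lemma outwardNormal_eq_zero (h : IsUnitRep N K) {x : Space d} (hx : x ∈ frontier K)
    (hf : ∀ p ∈ N, x ∉ facet N K p) : outwardNormal K x = 0 := by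
  rcases h.mem_facet_or hx with ⟨p, hp, hxp⟩ | ⟨p, hp, q, hq, hpx, hqx, hqp⟩
  · exact absurd hxp (hf p hp)
  · rw [outwardNormal, dif_neg]
    intro hu
    exact hqp (hu.unique (h.isOutwardNormal_of_active hq hqx) (h.isOutwardNormal_of_active hp hpx))

lemma measurableSet_facet (h : IsUnitRep N K) (p : Space d × ℝ) : MeasurableSet (facet N K p) := by
  classical
  have : facet N K p = K ∩ ({x | inner ℝ p.1 x = p.2} ∩
      ⋂ q ∈ N.filter fun q => q.1 ≠ p.1, {x | inner ℝ q.1 x < q.2}) := by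
    ext x; simp [facet, and_imp]; tauto
  rw [this]
  refine h.isClosed.measurableSet.inter (MeasurableSet.inter ?_ ?_)
  · exact (isClosed_eq (by fun_prop) continuous_const).measurableSet
  · exact Finset.measurableSet_biInter _ fun q _ =>
      (isOpen_lt (by fun_prop) continuous_const).measurableSet

lemma disjoint_facet (p q : Space d × ℝ) (hp : p ∈ N) (hpq : p ≠ q) :
    Disjoint (facet N K p) (facet N K q) := by
  rw [Set.disjoint_left]
  intro x hx hx'
  by_cases h1 : p.1 = q.1
  · refine hpq (Prod.ext h1 ?_)
    rw [← hx.2.1, ← hx'.2.1, h1]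
  · exact (hx'.2.2 p hp h1).ne hx.2.1

lemma surfaceMeasure_frontier_lt_top {m : ℕ} {N : Finset (Space (m + 1) × ℝ)}
    {K : Set (Space (m + 1))} (h : IsUnitRep N K) :
    (μHE[m] : Measure (Space (m + 1))) (frontier K) < ⊤ := by
  have hsub : frontier K ⊆ ⋃ p ∈ N, (K ∩ {x | inner ℝ p.1 x = p.2}) := by
    intro x hx
    obtain ⟨hxK, p, hp, hpx⟩ := h.mem_frontier_iff.1 hx
    exact Set.mem_biUnion hp ⟨hxK, hpx⟩
  refine (measure_mono hsub).trans_lt ?_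
  refine (measure_biUnion_finset_le _ _).trans_lt (ENNReal.sum_lt_top.2 fun p hp => ?_)
  exact surfaceMeasure_lt_top (by simp) (h.unit p hp) p.2 Set.inter_subset_right
    (h.bounded.subset Set.inter_subset_left)

lemma integral_eq_sum_facet (h : IsUnitRep N K) (μ : Measure (Space d)) (s : Set (Space d))
    (f : Space d → ℝ) (hs : MeasurableSet s) (hsK : s ⊆ frontier K)
    (hf : IntegrableOn f s μ)
    (h0 : ∀ x ∈ s, outwardNormal K x = 0 → f x = 0) :
    ∫ x in s, f x ∂μ = ∑ p ∈ N, ∫ x in s ∩ facet N K p, f x ∂μ := by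
  have hsub : (⋃ p ∈ N, s ∩ facet N K p) ⊆ s := by
    simp only [Set.iUnion_subset_iff]; exact fun p _ => Set.inter_subset_left
  rw [setIntegral_eq_of_subset_of_forall_sdiff_eq_zero hs hsub]
  · refine integral_biUnion_finset N (fun p _ => hs.inter (h.measurableSet_facet p)) ?_ ?_
    · intro p hp q _ hpq
      exact (disjoint_facet p q hp hpq).mono Set.inter_subset_right Set.inter_subset_right
    · exact fun p _ => hf.mono_set Set.inter_subset_left
  · rintro x ⟨hx, hx'⟩
    refine h0 x hx (h.outwardNormal_eq_zero (hsK hx) fun p hp hxp => hx' ?_)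
    exact Set.mem_biUnion hp ⟨hx, hxp⟩

end IsUnitRep
end Polytope

/-! ### The divergence theorem on a polytope -/

section Divergence

open Filter Topology

section Normal
variable {d : ℕ}

lemma norm_outwardNormal_le (K : Set (Space d)) (x : Space d) : ‖outwardNormal K x‖ ≤ 1 := by
  by_cases h : ∃! n, IsOutwardNormal K x n
  · rw [outwardNormal, dif_pos h]; exact h.choose_spec.1.1.le
  · rw [outwardNormal, dif_neg h]; simp

lemma abs_inner_outwardNormal_le {ω : Space d} (hω : ‖ω‖ = 1) (K : Set (Space d)) (x : Space d) :
    |inner ℝ ω (outwardNormal K x)| ≤ 1 := by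
  refine (abs_real_inner_le_norm _ _).trans ?_
  rw [hω, one_mul]
  exact norm_outwardNormal_le K x

namespace IsUnitRep
variable {N : Finset (Space d × ℝ)} {K : Set (Space d)}

lemma inner_outwardNormal_eq_sum (h : IsUnitRep N K) (ω : Space d) {x : Space d}
    (hx : x ∈ frontier K) : inner ℝ ω (outwardNormal K x) =
      ∑ p ∈ N, (facet N K p).indicator (fun _ => inner ℝ ω p.1) x := by
  by_cases hf : ∃ p ∈ N, x ∈ facet N K p
  · obtain ⟨p, hp, hxp⟩ := hf
    rw [h.outwardNormal_of_mem_facet hp hxp, Finset.sum_eq_single p]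
    · rw [Set.indicator_of_mem hxp]
    · intro q hq hqp
      exact Set.indicator_of_notMem
        (fun hxq => Set.disjoint_left.1 (disjoint_facet q p hq hqp) hxq hxp) _
    · exact fun h => absurd hp h
  · push Not at hf
    rw [h.outwardNormal_eq_zero hx hf, inner_zero_right]
    exact (Finset.sum_eq_zero fun p hp => Set.indicator_of_notMem (hf p hp) _).symm

lemma measurable_sum_facet (h : IsUnitRep N K) (ω : Space d) : Measurable fun x =>
    ∑ p ∈ N, (facet N K p).indicator (fun _ => inner ℝ ω p.1) x :=
  Finset.measurable_sum _ fun p _ => measurable_const.indicator (h.measurableSet_facet p)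

lemma aestronglyMeasurable_inner_outwardNormal (h : IsUnitRep N K) (ω : Space d)
    (μ : Measure (Space d)) : AEStronglyMeasurable (fun x => inner ℝ ω (outwardNormal K x))
      (μ.restrict (frontier K)) := by
  refine (h.measurable_sum_facet ω).aestronglyMeasurable.congr ?_
  filter_upwards [ae_restrict_mem isClosed_frontier.measurableSet] with x hx
  exact (h.inner_outwardNormal_eq_sum ω hx).symm

lemma measurableSet_inflow (h : IsUnitRep N K) (ω : Space d) : MeasurableSet (inflow ω K) := by
  have : inflow ω K = frontier K ∩
      {x | ∑ p ∈ N, (facet N K p).indicator (fun _ => inner ℝ ω p.1) x < 0} := by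
    ext x
    refine and_congr_right fun hx => ?_
    rw [h.inner_outwardNormal_eq_sum ω hx]; rfl
  rw [this]
  exact isClosed_frontier.measurableSet.inter
    (measurableSet_lt (h.measurable_sum_facet ω) measurable_const)

lemma measurableSet_outflow (h : IsUnitRep N K) (ω : Space d) : MeasurableSet (outflow ω K) := by
  have : outflow ω K = frontier K \ inflow ω K := by
    ext x
    simp only [outflow, inflow, Set.mem_sdiff, Set.mem_ofPred_eq, not_and, not_lt]
    tauto
  rw [this]
  exact isClosed_frontier.measurableSet.diff (h.measurableSet_inflow ω)

end IsUnitRep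

lemma inflow_subset_frontier (ω : Space d) (K : Set (Space d)) : inflow ω K ⊆ frontier K :=
  fun _ hx => hx.1

lemma outflow_subset_frontier (ω : Space d) (K : Set (Space d)) : outflow ω K ⊆ frontier K :=
  fun _ hx => hx.1

end Normal

variable {m : ℕ} {N : Finset (Space (m + 1) × ℝ)} {K : Set (Space (m + 1))}
  {ω : Space (m + 1)}

/-- A bounded measurable function times the normal component of a unit vector is integrable over
the boundary of a polytope. -/
lemma IsUnitRep.integrableOn_frontier (h : IsUnitRep N K) (hω : ‖ω‖ = 1)
    {f : Space (m + 1) → ℝ} {C : ℝ}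
    (hf : AEStronglyMeasurable f ((μHE[m] : Measure (Space (m + 1))).restrict (frontier K)))
    (hC : ∀ x ∈ frontier K, |f x| ≤ C) :
    IntegrableOn (fun x => f x * inner ℝ ω (outwardNormal K x)) (frontier K) μHE[m] := by
  have hfin : IsFiniteMeasure ((μHE[m] : Measure (Space (m + 1))).restrict (frontier K)) :=
    ⟨by rw [Measure.restrict_apply_univ]; exact h.surfaceMeasure_frontier_lt_top⟩
  refine Integrable.of_bound (hf.mul (h.aestronglyMeasurable_inner_outwardNormal ω _)) C ?_
  filter_upwards [ae_restrict_mem isClosed_frontier.measurableSet] with x hx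
  rw [Real.norm_eq_abs, abs_mul]
  exact (mul_le_of_le_one_right (abs_nonneg _) (abs_inner_outwardNormal_le hω K x)).trans (hC x hx)

/-- Almost every line in the direction `ω` crosses the boundary of the polytope in relative
interiors of facets only, and transversally. -/
lemma IsUnitRep.ae_transversal (h : IsUnitRep N K) (hω : ‖ω‖ = 1) :
    ∀ᵐ y : (Submodule.span ℝ {ω})ᗮ, ∀ t : ℝ, (y : Space (m + 1)) + t • ω ∈ frontier K →
      ∃ p ∈ N, (y : Space (m + 1)) + t • ω ∈ facet N K p ∧ inner ℝ p.1 ω ≠ 0 := by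
  have hωω : inner ℝ ω ω = (1 : ℝ) := by rw [real_inner_self_eq_norm_sq, hω]; norm_num
  -- a vector orthogonal to `ω` lies in its span only if it vanishes
  have hspan : ∀ z : Space (m + 1), inner ℝ z ω = 0 → z ≠ 0 → z ∉ Submodule.span ℝ {ω} := by
    intro z hz hz0 hzs
    obtain ⟨c, rfl⟩ := Submodule.mem_span_singleton.1 hzs
    rw [real_inner_smul_left, hωω, mul_one] at hz
    exact hz0 (by rw [hz, zero_smul])
  have h1 : ∀ p ∈ N, ∀ᵐ y : (Submodule.span ℝ {ω})ᗮ, inner ℝ p.1 ω = 0 →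
      inner ℝ p.1 (y : Space (m + 1)) ≠ p.2 := by
    intro p hp
    by_cases hpω : inner ℝ p.1 ω = 0
    · have hp0 : p.1 ≠ 0 := by
        intro h0; have := h.unit p hp; rw [h0, norm_zero] at this; norm_num at this
      filter_upwards [measure_eq_zero_iff_ae_notMem.1
        (volume_shadow_inner_eq_zero (hspan _ hpω hp0) p.2)] with y hy _ using hy
    · exact Eventually.of_forall fun y h0 => absurd h0 hpω
  have h2 : ∀ p ∈ N, ∀ q ∈ N, ∀ᵐ y : (Submodule.span ℝ {ω})ᗮ, inner ℝ p.1 ω ≠ 0 →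
      inner ℝ q.1 ω ≠ 0 → q.1 ≠ p.1 → q.1 ≠ -p.1 → ∀ t : ℝ,
      ¬ (inner ℝ p.1 ((y : Space (m + 1)) + t • ω) = p.2 ∧
        inner ℝ q.1 ((y : Space (m + 1)) + t • ω) = q.2) := by
    intro p hp q hq
    by_cases hc : inner ℝ p.1 ω ≠ 0 ∧ inner ℝ q.1 ω ≠ 0 ∧ q.1 ≠ p.1 ∧ q.1 ≠ -p.1
    · obtain ⟨hpω, hqω, hqp, hqp'⟩ := hc
      set z := inner ℝ q.1 ω • p.1 - inner ℝ p.1 ω • q.1 with hz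
      have hz1 : inner ℝ z ω = 0 := by
        rw [hz, inner_sub_left, real_inner_smul_left, real_inner_smul_left]; ring
      have hz0 : z ≠ 0 := by
        intro h0
        have hmem : q.1 ∈ Submodule.span ℝ {p.1} := by
          refine Submodule.mem_span_singleton.2 ⟨(inner ℝ p.1 ω)⁻¹ * inner ℝ q.1 ω, ?_⟩
          rw [mul_smul, sub_eq_zero.1 h0, smul_smul, inv_mul_cancel₀ hpω, one_smul]
        rcases eq_or_eq_neg_of_mem_span (h.unit p hp) (h.unit q hq) hmem with h | h
        exacts [hqp h, hqp' h]
      filter_upwards [measure_eq_zero_iff_ae_notMem.1 (volume_shadow_inner_eq_zero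
        (hspan z hz1 hz0) (inner ℝ q.1 ω * p.2 - inner ℝ p.1 ω * q.2))] with y hy _ _ _ _ t ht
      refine hy ?_
      simp only [inner_add_right, inner_smul_right] at ht
      rw [hz, inner_sub_left, real_inner_smul_left, real_inner_smul_left,
        ← ht.1, ← ht.2]
      ring
    · exact Eventually.of_forall fun y a b c e => absurd ⟨a, b, c, e⟩ hc
  have h1' := (eventually_all_finset N).2 h1
  have h2' := (eventually_all_finset N).2 fun p hp => (eventually_all_finset N).2 (h2 p hp)
  filter_upwards [h1', h2'] with y hy1 hy2 t ht
  have htr : ∀ p ∈ N, inner ℝ p.1 ((y : Space (m + 1)) + t • ω) = p.2 → inner ℝ p.1 ω ≠ 0 := by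
    intro p hp hpt h0
    refine hy1 p hp h0 ?_
    rwa [inner_add_right, inner_smul_right, h0, mul_zero, add_zero] at hpt
  rcases h.mem_facet_or ht with ⟨p, hp, hxp⟩ | ⟨p, hp, q, hq, hpx, hqx, hqp⟩
  · exact ⟨p, hp, hxp, htr p hp hxp.2.1⟩
  · exact absurd ⟨hpx, hqx⟩ (hy2 p hp q hq (htr p hp hpx) (htr q hq hqx) hqp
      (h.ne_neg_of_active hp hq hpx hqx) t)

/-- On a line crossing the boundary transversally, the sum over the facets of the signed values of
`F` at the crossing points is the increment of `F` along the chord cut out by the polytope. -/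
lemma IsUnitRep.integral_chord (h : IsUnitRep N K) (hω : ‖ω‖ = 1) {F : Space (m + 1) → ℝ}
    (hF : ContDiff ℝ 1 F) (y : (Submodule.span ℝ {ω})ᗮ)
    (hy : ∀ t : ℝ, (y : Space (m + 1)) + t • ω ∈ frontier K →
      ∃ p ∈ N, (y : Space (m + 1)) + t • ω ∈ facet N K p ∧ inner ℝ p.1 ω ≠ 0) :
    ∫ t : ℝ, K.indicator (fun x => fderiv ℝ F x ω) ((y : Space (m + 1)) + t • ω) =
      ∑ p ∈ N, Real.sign (inner ℝ p.1 ω) *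
        (graphMap ω p.1 p.2 ⁻¹' facet N K p).indicator (fun y => F (graphMap ω p.1 p.2 y)) y := by
  set J : Set ℝ := {t | (y : Space (m + 1)) + t • ω ∈ K} with hJ
  have hcont : Continuous fun t : ℝ => (y : Space (m + 1)) + t • ω := by fun_prop
  have hJc : IsClosed J := h.isClosed.preimage hcont
  -- the chord is maximal on both sides of a transversal crossing
  have hup : ∀ p ∈ N, 0 < inner ℝ p.1 ω → ∀ t s, (y : Space (m + 1)) + t • ω ∈ facet N K p →
      s ∈ J → s ≤ t := by
    intro p hp hpω t s ht hs
    have h1 := (h.mem_iff _).1 hs p hp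
    have h2 := ht.2.1
    rw [inner_add_right, inner_smul_right] at h1 h2
    by_contra hlt
    push Not at hlt
    nlinarith
  have hdown : ∀ p ∈ N, inner ℝ p.1 ω < 0 → ∀ t s, (y : Space (m + 1)) + t • ω ∈ facet N K p →
      s ∈ J → t ≤ s := by
    intro p hp hpω t s ht hs
    have h1 := (h.mem_iff _).1 hs p hp
    have h2 := ht.2.1
    rw [inner_add_right, inner_smul_right] at h1 h2
    by_contra hlt
    push Not at hlt
    nlinarith
  have hgraph : ∀ p ∈ N, inner ℝ p.1 ω ≠ 0 → y ∈ graphMap ω p.1 p.2 ⁻¹' facet N K p →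
      ∃ t, (y : Space (m + 1)) + t • ω ∈ facet N K p := fun p _ _ hyp => ⟨_, hyp⟩
  by_cases hne : J.Nonempty
  · have hJb : Bornology.IsBounded J := by
      obtain ⟨R, hR⟩ := h.bounded.exists_norm_le
      refine isBounded_iff_forall_norm_le.2 ⟨R + ‖(y : Space (m + 1))‖, fun t ht => ?_⟩
      have h1 := hR _ ht
      have h2 : t • ω = ((y : Space (m + 1)) + t • ω) - y := by abel
      calc ‖t‖ = ‖t • ω‖ := by rw [norm_smul, hω, mul_one]
        _ ≤ _ := by rw [h2]; exact (norm_sub_le _ _).trans (by gcongr)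
    set b := sSup J
    set a := sInf J
    have hbJ : b ∈ J := hJc.csSup_mem hne hJb.bddAbove
    have haJ : a ∈ J := hJc.csInf_mem hne hJb.bddBelow
    have hab : a ≤ b := csInf_le hJb.bddBelow hbJ
    have hJI : J = Set.Icc a b := by
      refine Set.Subset.antisymm
        (fun t ht => ⟨csInf_le hJb.bddBelow ht, le_csSup hJb.bddAbove ht⟩) ?_
      have hconv : Convex ℝ J := by
        intro s hs t ht α β hα hβ hαβ
        have := h.convex hs ht hα hβ hαβ
        have h3 : α • ((y : Space (m + 1)) + s • ω) + β • ((y : Space (m + 1)) + t • ω) =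
            y + (α • s + β • t) • ω := by
          simp only [smul_add, add_smul, smul_eq_mul, smul_smul]
          have : (y : Space (m + 1)) = α • (y : Space (m + 1)) + β • (y : Space (m + 1)) := by
            rw [← add_smul, hαβ, one_smul]
          nth_rewrite 3 [this]
          abel
        rw [h3] at this
        exact this
      exact hconv.ordConnected.out haJ hbJ
    have hfr : ∀ t ∈ J, (∀ᶠ ε : ℝ in 𝓝[>] 0, t + ε ∉ J) ∨ (∀ᶠ ε : ℝ in 𝓝[>] 0, t - ε ∉ J) →
        (y : Space (m + 1)) + t • ω ∈ frontier K := by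
      intro t ht hor
      rw [h.isClosed.frontier_eq]
      refine ⟨ht, fun hint => ?_⟩
      have hnhds : ∀ᶠ s in 𝓝 t, s ∈ J :=
        (hcont.continuousAt.eventually (isOpen_interior.mem_nhds hint)).mono
          fun s hs => (interior_subset hs : (y : Space (m + 1)) + s • ω ∈ K)
      have hp : Tendsto (fun ε : ℝ => t + ε) (𝓝[>] 0) (𝓝 t) := by
        have : Continuous fun ε : ℝ => t + ε := by fun_prop
        simpa using (this.tendsto 0).mono_left nhdsWithin_le_nhds
      have hm : Tendsto (fun ε : ℝ => t - ε) (𝓝[>] 0) (𝓝 t) := by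
        have : Continuous fun ε : ℝ => t - ε := by fun_prop
        simpa using (this.tendsto 0).mono_left nhdsWithin_le_nhds
      rcases hor with ho | ho
      · obtain ⟨ε, h1, h2⟩ := (ho.and (hp.eventually hnhds)).exists
        exact h1 h2
      · obtain ⟨ε, h1, h2⟩ := (ho.and (hm.eventually hnhds)).exists
        exact h1 h2
    have hbout : ∀ᶠ ε : ℝ in 𝓝[>] 0, b + ε ∉ J := by
      filter_upwards [self_mem_nhdsWithin] with ε hε hJ'
      have := le_csSup hJb.bddAbove hJ'
      have hε : (0 : ℝ) < ε := hε
      linarith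
    have haout : ∀ᶠ ε : ℝ in 𝓝[>] 0, a - ε ∉ J := by
      filter_upwards [self_mem_nhdsWithin] with ε hε hJ'
      have := csInf_le hJb.bddBelow hJ'
      have hε : (0 : ℝ) < ε := hε
      linarith
    obtain ⟨p, hp, hbp, hpω⟩ := hy b (hfr b hbJ (Or.inl hbout))
    obtain ⟨q, hq, haq, hqω⟩ := hy a (hfr a haJ (Or.inr haout))
    have hpω : 0 < inner ℝ p.1 ω := by
      refine lt_of_le_of_ne (not_lt.1 fun hlt => ?_) hpω.symm
      obtain ⟨ε, h1, h2⟩ := (hbout.and (h.eventually_add_smul_mem hbp hlt.le)).exists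
      refine h1 ?_
      change (y : Space (m + 1)) + (b + ε) • ω ∈ K
      rwa [add_smul, ← add_assoc]
    have hqω : inner ℝ q.1 ω < 0 := by
      refine lt_of_le_of_ne (not_lt.1 fun hlt => ?_) hqω
      obtain ⟨ε, h1, h2⟩ := (haout.and (h.eventually_add_smul_mem (e := -ω) haq
        (by rw [inner_neg_right]; linarith))).exists
      refine h1 ?_
      change (y : Space (m + 1)) + (a - ε) • ω ∈ K
      rwa [sub_smul, ← add_sub_assoc, sub_eq_add_neg, ← smul_neg]
    have hbg := add_smul_eq_graphMap hpω.ne' hbp.2.1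
    have hag := add_smul_eq_graphMap hqω.ne haq.2.1
    rw [Finset.sum_eq_add (a := p) (b := q) (by rintro rfl; linarith)]
    · have hyp : y ∈ graphMap ω p.1 p.2 ⁻¹' facet N K p := by
        rw [Set.mem_preimage, ← hbg]; exact hbp
      have hyq : y ∈ graphMap ω q.1 q.2 ⁻¹' facet N K q := by
        rw [Set.mem_preimage, ← hag]; exact haq
      rw [Set.indicator_of_mem hyp, Set.indicator_of_mem hyq, Real.sign_of_pos hpω,
        Real.sign_of_neg hqω, ← hbg, ← hag]
      have hind : (fun t : ℝ => K.indicator (fun x => fderiv ℝ F x ω)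
          ((y : Space (m + 1)) + t • ω)) =
          (Set.Icc a b).indicator fun t => fderiv ℝ F ((y : Space (m + 1)) + t • ω) ω := by
        rw [← hJI]
        funext t
        by_cases ht : t ∈ J
        · rw [Set.indicator_of_mem ht, Set.indicator_of_mem (show _ ∈ K from ht)]
        · rw [Set.indicator_of_notMem ht, Set.indicator_of_notMem (show _ ∉ K from ht)]
      rw [hind, integral_indicator measurableSet_Icc, integral_Icc_eq_integral_Ioc,
        ← intervalIntegral.integral_of_le hab]
      rw [intervalIntegral.integral_eq_sub_of_hasDerivAt
        (f := fun t : ℝ => F ((y : Space (m + 1)) + t • ω))]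
      · ring
      · intro t _
        have h1 : HasDerivAt (fun t : ℝ => (y : Space (m + 1)) + t • ω) ω t := by
          simpa using ((hasDerivAt_id t).smul_const ω).const_add (y : Space (m + 1))
        exact ((hF.differentiable one_ne_zero _).hasFDerivAt).comp_hasDerivAt t h1
      · refine Continuous.intervalIntegrable ?_ _ _
        exact ((hF.continuous_fderiv one_ne_zero).comp hcont).clm_apply continuous_const
    · intro c hc hcpq
      by_cases hyc : y ∈ graphMap ω c.1 c.2 ⁻¹' facet N K c
      · rcases lt_trichotomy (inner ℝ c.1 ω) 0 with hcω | hcω | hcω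
        · obtain ⟨t, ht⟩ := hgraph c hc hcω.ne hyc
          have : t = a := le_antisymm (hdown c hc hcω t a ht haJ) (hdown q hq hqω a t haq ht.1)
          rw [this] at ht
          exact absurd haq (Set.disjoint_left.1 (disjoint_facet c q hc hcpq.2) ht)
        · rw [hcω, Real.sign_zero, zero_mul]
        · obtain ⟨t, ht⟩ := hgraph c hc hcω.ne' hyc
          have : t = b := le_antisymm (hup p hp hpω b t hbp ht.1) (hup c hc hcω t b ht hbJ)
          rw [this] at ht
          exact absurd hbp (Set.disjoint_left.1 (disjoint_facet c p hc hcpq.1) ht)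
      · rw [Set.indicator_of_notMem hyc, mul_zero]
    · exact fun h => absurd hp h
    · exact fun h => absurd hq h
  · have hout : ∀ t : ℝ, (y : Space (m + 1)) + t • ω ∉ K := fun t ht => hne ⟨t, ht⟩
    rw [Finset.sum_eq_zero]
    · simp only [Set.indicator_of_notMem (hout _), integral_zero]
    · intro c hc
      by_cases hcω : inner ℝ c.1 ω = 0
      · rw [hcω, Real.sign_zero, zero_mul]
      · rw [Set.indicator_of_notMem, mul_zero]
        intro hyc
        obtain ⟨t, ht⟩ := hgraph c hc hcω hyc
        exact hout t ht.1

/-- The divergence theorem on a convex polytope for a vector field of constant direction `ω`. -/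
theorem IsUnitRep.integral_fderiv_eq (h : IsUnitRep N K) (hω : ‖ω‖ = 1)
    {F : Space (m + 1) → ℝ} (hF : ContDiff ℝ 1 F) :
    ∫ x in K, fderiv ℝ F x ω =
      ∫ x in frontier K, F x * inner ℝ ω (outwardNormal K x) ∂μHE[m] := by
  have hV : Module.finrank ℝ (Space (m + 1)) = m + 1 := by simp
  have hfrK : frontier K ⊆ K := h.isClosed.frontier_subset
  obtain ⟨C, hC⟩ := h.isCompact.exists_bound_of_continuousOn hF.continuous.continuousOn
  have hfin : IsFiniteMeasure ((μHE[m] : Measure (Space (m + 1))).restrict (frontier K)) :=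
    ⟨by rw [Measure.restrict_apply_univ]; exact h.surfaceMeasure_frontier_lt_top⟩
  have hFint : IntegrableOn F (frontier K) μHE[m] := by
    refine Integrable.of_bound hF.continuous.aestronglyMeasurable C ?_
    filter_upwards [ae_restrict_mem isClosed_frontier.measurableSet] with x hx
      using hC x (hfrK hx)
  have hR : ∫ x in frontier K, F x * inner ℝ ω (outwardNormal K x) ∂μHE[m] =
      ∑ p ∈ N, ∫ y : (Submodule.span ℝ {ω})ᗮ, Real.sign (inner ℝ p.1 ω) *
        (graphMap ω p.1 p.2 ⁻¹' facet N K p).indicator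
          (fun y => F (graphMap ω p.1 p.2 y)) y := by
    rw [h.integral_eq_sum_facet _ _ _ isClosed_frontier.measurableSet subset_rfl
      (h.integrableOn_frontier hω hF.continuous.aestronglyMeasurable fun x hx => hC x (hfrK hx))
      (fun x _ hx => by rw [hx, inner_zero_right, mul_zero])]
    refine Finset.sum_congr rfl fun p hp => ?_
    rw [Set.inter_eq_self_of_subset_right (h.facet_subset_frontier hp),
      setIntegral_congr_fun (h.measurableSet_facet p) (g := fun x => F x * inner ℝ p.1 ω)
        (fun x hx => by
          rw [h.outwardNormal_of_mem_facet hp hx, real_inner_comm]),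
      integral_mul_const, integral_const_mul]
    by_cases hpω : inner ℝ p.1 ω = 0
    · rw [hpω, Real.sign_zero, mul_zero, zero_mul]
    · rw [setIntegral_surfaceMeasure hV hω (h.unit p hp) hpω (fun x hx => hx.2.1),
        integral_indicator ((measurableEmbedding_graphMap ω p.1 p.2).measurable
          (h.measurableSet_facet p))]
      rcases lt_or_gt_of_ne hpω with h0 | h0
      · rw [Real.sign_of_neg h0, abs_of_neg h0]; field_simp
      · rw [Real.sign_of_pos h0, abs_of_pos h0]; field_simp
  have hint : ∀ p ∈ N, Integrable fun y : (Submodule.span ℝ {ω})ᗮ =>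
      Real.sign (inner ℝ p.1 ω) * (graphMap ω p.1 p.2 ⁻¹' facet N K p).indicator
        (fun y => F (graphMap ω p.1 p.2 y)) y := by
    intro p hp
    by_cases hpω : inner ℝ p.1 ω = 0
    · simp [hpω]
    · refine Integrable.const_mul ?_ _
      have h1 : IntegrableOn F (facet N K p) μHE[m] := hFint.mono_set (h.facet_subset_frontier hp)
      rw [IntegrableOn, surfaceMeasure_restrict_eq_map hV hω (h.unit p hp) hpω
        (fun x hx => hx.2.1), integrable_smul_measure (by positivity) (by simp),
        (measurableEmbedding_graphMap ω p.1 p.2).integrable_map_iff] at h1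
      exact (integrable_indicator_iff ((measurableEmbedding_graphMap ω p.1 p.2).measurable
          (h.measurableSet_facet p))).2 h1
  rw [hR, ← integral_finsetSum N hint]
  have hfc : Continuous fun x => fderiv ℝ F x ω :=
    (hF.continuous_fderiv one_ne_zero).clm_apply continuous_const
  have hind : Integrable (K.indicator fun x => fderiv ℝ F x ω) :=
    (integrable_indicator_iff h.isClosed.measurableSet).2
      (hfc.continuousOn.integrableOn_compact h.isCompact)
  rw [← integral_indicator h.isClosed.measurableSet,
    ← (measurePreserving_add_smul hω).integral_comp (measurableEmbedding_add_smul hω)]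
  refine (integral_prod _ (((measurePreserving_add_smul hω).integrable_comp_emb
      (measurableEmbedding_add_smul hω)).2 hind)).trans ?_
  refine integral_congr_ae ?_
  filter_upwards [h.ae_transversal hω] with y hy
  exact h.integral_chord hω hF y hy

end Divergence

/-! ### Mollification of functions with a weak gradient -/

section Mollify

open Filter Topology ContinuousLinearMap
open scoped Convolution

variable {d : ℕ}

/-- The convolution of `f` with the mollifier `φ`. -/
def mollify (φ : ContDiffBump (0 : Space d)) (f : Space d → ℝ) : Space d → ℝ :=
  φ.normed volume ⋆[lsmul ℝ ℝ, volume] f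

lemma mollify_eq_integral (φ : ContDiffBump (0 : Space d)) (f : Space d → ℝ) (x : Space d) :
    mollify φ f x = ∫ z, φ.normed volume (x - z) * f z := by
  rw [mollify, convolution_lsmul_swap]; rfl

lemma mollify_eq_convolution (φ : ContDiffBump (0 : Space d)) (f : Space d → ℝ) :
    mollify φ f = f ⋆[lsmul ℝ ℝ, volume] φ.normed volume := by
  funext x
  rw [mollify_eq_integral, convolution_lsmul]
  exact integral_congr_ae (Eventually.of_forall fun z => by simp [mul_comm])

lemma normed_sub_comm (φ : ContDiffBump (0 : Space d)) (x z : Space d) :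
    φ.normed volume (x - z) = φ.normed volume (z - x) := by
  rw [← neg_sub, ContDiffBump.normed_neg]

lemma contDiff_mollify (φ : ContDiffBump (0 : Space d)) {f : Space d → ℝ}
    (hf : LocallyIntegrable f) : ContDiff ℝ 1 (mollify φ f) := by
  rw [mollify_eq_convolution]
  exact (φ.hasCompactSupport_normed).contDiff_convolution_right (n := 1) _ hf φ.contDiff_normed

lemma dist_mollify_le (φ : ContDiffBump (0 : Space d)) {f : Space d → ℝ}
    (hf : AEStronglyMeasurable f) {x : Space d} {a ε : ℝ} (hε : 0 ≤ ε)
    (h : ∀ z ∈ Metric.ball x φ.rOut, dist (f z) a ≤ ε) : dist (mollify φ f x) a ≤ ε :=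
  dist_convolution_le hε φ.support_normed_eq.subset φ.nonneg_normed φ.integral_normed hf h

lemma abs_mollify_le (φ : ContDiffBump (0 : Space d)) {f : Space d → ℝ}
    (hf : AEStronglyMeasurable f) {C : ℝ} (hC : ∀ x, |f x| ≤ C) (x : Space d) :
    |mollify φ f x| ≤ C := by
  have := dist_mollify_le φ hf (x := x) (a := 0) ((abs_nonneg _).trans (hC x)) fun z _ => by
    simpa using hC z
  simpa using this

/-- At a distance from the complement of `U` the derivative of the mollified function is the
mollified weak derivative. -/
lemma fderiv_mollify (φ : ContDiffBump (0 : Space d)) {U : Set (Space d)} (hU : MeasurableSet U)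
    {v : Space d → ℝ} {G : Space d → Space d} (hG : IsWeakGradient U v G)
    (hv : LocallyIntegrable (U.indicator v)) {x : Space d}
    (hx : Metric.closedBall x φ.rOut ⊆ U) (e : Space d) :
    fderiv ℝ (mollify φ (U.indicator v)) x e =
      mollify φ (U.indicator fun z => inner ℝ (G z) e) x := by
  have hd : HasFDerivAt (mollify φ (U.indicator v))
      ((U.indicator v ⋆[(lsmul ℝ ℝ).precompR (Space d), volume]
        fderiv ℝ (φ.normed volume)) x) x := by
    rw [mollify_eq_convolution]
    exact (φ.hasCompactSupport_normed).hasFDerivAt_convolution_right (lsmul ℝ ℝ) hv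
      (φ.contDiff_normed (n := 1)) x
  have hψ : ContDiff ℝ 1 (φ.normed (volume : Measure (Space d))) := φ.contDiff_normed (n := 1)
  rw [hd.fderiv, convolution_precompR_apply (lsmul ℝ ℝ) hv
    (φ.hasCompactSupport_normed.fderiv (𝕜 := ℝ)) (hψ.continuous_fderiv one_ne_zero),
    convolution_lsmul, mollify_eq_integral]
  set η : Space d → ℝ := fun z => φ.normed volume (x - z) with hη
  have hηsupp : tsupport η ⊆ Metric.closedBall x φ.rOut := by
    refine closure_minimal ?_ Metric.isClosed_closedBall
    intro z hz
    have h1 : x - z ∈ Function.support (φ.normed (volume : Measure (Space d))) := hz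
    rw [φ.support_normed_eq, mem_ball_zero_iff, ← dist_eq_norm, dist_comm] at h1
    exact h1.le
  have hηc : HasCompactSupport η :=
    (isCompact_closedBall x φ.rOut).of_isClosed_subset (isClosed_tsupport η) hηsupp
  have hηs : ContDiff ℝ (⊤ : ℕ∞) η := φ.contDiff_normed.comp (contDiff_const.sub contDiff_id)
  have hder : ∀ z, fderiv ℝ η z e = -fderiv ℝ (φ.normed volume) (x - z) e := by
    intro z
    have h1 : HasFDerivAt (fun z : Space d => x - z) (-ContinuousLinearMap.id ℝ (Space d)) z := by
      simpa using (hasFDerivAt_id z).const_sub x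
    have h2 := ((hψ.differentiable one_ne_zero) (x - z)).hasFDerivAt.comp z h1
    rw [show fderiv ℝ η z = _ from h2.fderiv]
    simp
  have key := hG η hηs hηc (hηsupp.trans hx) e
  rw [← integral_indicator hU, ← integral_indicator hU, ← neg_inj, neg_neg] at key
  rw [← integral_neg] at key
  refine Eq.trans (integral_congr_ae (Eventually.of_forall fun z => ?_))
    (key.trans (integral_congr_ae (Eventually.of_forall fun z => ?_)))
  · by_cases hz : z ∈ U <;> simp [hz, hder]
  · by_cases hz : z ∈ U <;> simp [hz, hη, mul_comm]

/-- The mollified functions converge, jointly in the parameter and in the point, at a point of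
continuity. -/
lemma tendsto_mollify {φ : ℕ → ContDiffBump (0 : Space d)}
    (hφ : Tendsto (fun k => (φ k).rOut) atTop (𝓝 0)) {f : Space d → ℝ}
    (hf : AEStronglyMeasurable f) {z : Space d} {a : ℝ} (hz : Tendsto f (𝓝 z) (𝓝 a)) :
    Tendsto (fun p : ℕ × Space d => mollify (φ p.1) f p.2) (atTop ×ˢ 𝓝 z) (𝓝 a) :=
  ContDiffBump.convolution_tendsto_right (φ := fun p : ℕ × Space d => φ p.1) (g := fun _ => f)
    (k := fun p => p.2) (hφ.comp tendsto_fst) (Eventually.of_forall fun _ => hf)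
    (hz.comp tendsto_snd) tendsto_snd

end Mollify

/-! ### The divergence theorem for weak gradients -/

section WeakDivergence

open Filter Topology

lemma integral_comp_shrink {d : ℕ} (c : Space d) (r : ℝ) (f : Space d → ℝ) :
    ∫ x, f (c + r • (x - c)) = |(r ^ d)⁻¹| * ∫ x, f x := by
  have h1 : ∀ x, f (c + r • (x - c)) = (fun y => f (y + (c - r • c))) (r • x) := by
    intro x
    change _ = f (r • x + (c - r • c))
    congr 1
    rw [smul_sub]; abel
  simp only [h1]
  rw [Measure.integral_comp_smul volume (fun y => f (y + (c - r • c))),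
    integral_add_right_eq_self (μ := volume) f, smul_eq_mul]
  simp

variable {m : ℕ} {N : Finset (Space (m + 1) × ℝ)} {K : Set (Space (m + 1))}
  {ω : Space (m + 1)}

lemma ae_restrict_interior_eq {d : ℕ} {N : Finset (Space d × ℝ)} {K : Set (Space d)}
    (h : IsUnitRep N K) : (volume.restrict K : Measure (Space d)) = volume.restrict (interior K) :=
  Measure.restrict_congr_set (interior_ae_eq_of_null_frontier
    (h.convex.addHaar_frontier volume)).symm

/-- The divergence theorem for the square of the mollified function, rescaled towards an interior
point `c` so that only values well inside `K` occur; the mollifier on the weak derivative has been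
moved to the other factor by Fubini's theorem. -/
lemma IsUnitRep.integral_mollify (h : IsUnitRep N K) (hω : ‖ω‖ = 1) {v : Space (m + 1) → ℝ}
    {G : Space (m + 1) → Space (m + 1)} (hG : IsWeakGradient (interior K) v G)
    (hv : Measurable ((interior K).indicator v)) {C : ℝ}
    (hC : ∀ x, |(interior K).indicator v x| ≤ C)
    (hfint : Integrable ((interior K).indicator v))
    (hD : Integrable ((interior K).indicator fun z => inner ℝ (G z) ω))
    (φ : ContDiffBump (0 : Space (m + 1))) (c : Space (m + 1)) {r : ℝ} (hr : 0 < r)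
    (hcr : ∀ x ∈ K, Metric.closedBall (c + r • (x - c)) φ.rOut ⊆ interior K) :
    2 * r * |(r ^ (m + 1))⁻¹| * ∫ z, (interior K).indicator (fun z => inner ℝ (G z) ω) z *
        mollify φ ({w | c + r⁻¹ • (w - c) ∈ K}.indicator
          (mollify φ ((interior K).indicator v))) z =
      ∫ x in frontier K, mollify φ ((interior K).indicator v) (c + r • (x - c)) ^ 2 *
        inner ℝ ω (outwardNormal K x) ∂μHE[m] := by
  have hUm : MeasurableSet (interior K) := isOpen_interior.measurableSet
  set f := (interior K).indicator v with hf
  set D := (interior K).indicator fun z => inner ℝ (G z) ω with hDdef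
  set u := mollify φ f with hu
  set A : Set (Space (m + 1)) := {w | c + r⁻¹ • (w - c) ∈ K} with hA
  have hu1 : ContDiff ℝ 1 u := contDiff_mollify φ hfint.locallyIntegrable
  have hS : ContDiff ℝ 1 fun x : Space (m + 1) => u (c + r • (x - c)) :=
    hu1.comp (by fun_prop)
  have hF : ContDiff ℝ 1 fun x : Space (m + 1) => u (c + r • (x - c)) ^ 2 := hS.pow 2
  rw [← h.integral_fderiv_eq hω hF]
  have hder : ∀ x ∈ K, fderiv ℝ (fun x : Space (m + 1) => u (c + r • (x - c)) ^ 2) x ω =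
      (2 * r) * (u (c + r • (x - c)) * mollify φ D (c + r • (x - c))) := by
    intro x hx
    have h1 : HasFDerivAt (fun x : Space (m + 1) => c + r • (x - c))
        (r • ContinuousLinearMap.id ℝ (Space (m + 1))) x :=
      (((hasFDerivAt_id x).sub_const c).const_smul r).const_add c
    have h2 := (((hu1.differentiable one_ne_zero) (c + r • (x - c))).hasFDerivAt.comp x h1).pow 2
    rw [show fderiv ℝ (fun x : Space (m + 1) => u (c + r • (x - c)) ^ 2) x = _ from h2.fderiv]
    have h3 := fderiv_mollify φ hUm hG hfint.locallyIntegrable (hcr x hx) ω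
    simp only [Nat.add_one_sub_one, pow_one, _root_.smul_apply,
      ContinuousLinearMap.comp_apply, ContinuousLinearMap.id_apply, map_smul, smul_eq_mul,
      Function.comp_apply, nsmul_eq_mul, hu]
    rw [h3]
    push_cast
    ring
  rw [setIntegral_congr_fun h.isClosed.measurableSet hder, integral_const_mul, mul_assoc]
  congr 1
  -- rescale
  have hAm : MeasurableSet A := (h.isClosed.preimage (by fun_prop)).measurableSet
  have hind : ∀ x, K.indicator (fun x => u (c + r • (x - c)) * mollify φ D (c + r • (x - c))) x =
      (fun w => A.indicator u w * mollify φ D w) (c + r • (x - c)) := by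
    intro x
    have hxA : c + r • (x - c) ∈ A ↔ x ∈ K := by
      rw [hA, Set.mem_ofPred_eq, add_sub_cancel_left, smul_smul, inv_mul_cancel₀ hr.ne', one_smul,
        add_sub_cancel]
    by_cases hx : x ∈ K
    · simp only [Set.indicator_of_mem hx, Set.indicator_of_mem (hxA.2 hx)]
    · simp only [Set.indicator_of_notMem hx, Set.indicator_of_notMem (fun h' => hx (hxA.1 h')),
        zero_mul]
  rw [← integral_indicator h.isClosed.measurableSet]
  simp_rw [hind]
  rw [integral_comp_shrink c r fun w => A.indicator u w * mollify φ D w]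
  congr 1
  -- exchange the order of integration
  have hψint : Integrable (φ.normed (volume : Measure (Space (m + 1)))) := φ.integrable_normed
  have hprod : Integrable (Function.uncurry fun w z => A.indicator u w *
      (φ.normed volume (w - z) * D z)) (volume.prod volume) := by
    have h1 := hD.convolution_integrand (ContinuousLinearMap.lsmul ℝ ℝ) hψint
    have h2 : AEStronglyMeasurable (fun p : Space (m + 1) × Space (m + 1) => A.indicator u p.1)
        (volume.prod volume) :=
      ((hu1.continuous.measurable.indicator hAm).comp measurable_fst).aestronglyMeasurable
    refine (h1.bdd_mul (c := C) h2 (Eventually.of_forall fun p => ?_)).congr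
      (Eventually.of_forall fun p => ?_)
    · have hC0 : 0 ≤ C := (abs_nonneg _).trans (hC 0)
      by_cases hp : p.1 ∈ A
      · rw [Set.indicator_of_mem hp, Real.norm_eq_abs]
        exact abs_mollify_le φ hv.aestronglyMeasurable hC _
      · rw [Set.indicator_of_notMem hp, norm_zero]; exact hC0
    · simp [Function.uncurry, mul_comm]
  have hswap := integral_integral_swap hprod
  simp_rw [integral_const_mul] at hswap
  simp_rw [mollify_eq_integral φ D]
  rw [hswap]
  refine integral_congr_ae (Eventually.of_forall fun z => ?_)
  simp only [mollify_eq_integral φ (A.indicator u)]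
  rw [← integral_const_mul]
  refine integral_congr_ae (Eventually.of_forall fun w => ?_)
  simp only [normed_sub_comm φ z w]
  ring

/-- The divergence theorem on a convex polytope for `v² ω`, where `v` is continuous up to the
boundary and has a square-integrable weak gradient. -/
theorem IsUnitRep.integral_mul_weakGradient (h : IsUnitRep N K) (hω : ‖ω‖ = 1)
    {v : Space (m + 1) → ℝ} (hv : ContinuousOn v K) {G : Space (m + 1) → Space (m + 1)}
    (hG : IsWeakGradient (interior K) v G) (hG2 : MemLp G 2 (volume.restrict (interior K))) :
    2 * ∫ x in K, inner ℝ ω (G x) * v x =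
      ∫ x in frontier K, v x ^ 2 * inner ℝ ω (outwardNormal K x) ∂μHE[m] := by
  have hUm : MeasurableSet (interior K) := isOpen_interior.measurableSet
  have hfrK : frontier K ⊆ K := h.isClosed.frontier_subset
  obtain ⟨C, hC⟩ := h.isCompact.exists_bound_of_continuousOn hv
  obtain ⟨c, hc⟩ := h.nonempty
  have hcK : c ∈ K := interior_subset hc
  have hC0 : 0 ≤ C := (norm_nonneg _).trans (hC c hcK)
  obtain ⟨ρ, hρ, hball⟩ := Metric.isOpen_iff.1 isOpen_interior c hc
  set f := (interior K).indicator v with hf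
  set D := (interior K).indicator fun z => inner ℝ (G z) ω with hDdef
  have hfm : Measurable f := by
    classical
    rw [hf, ← Set.piecewise_eq_indicator]
    exact (hv.mono interior_subset).measurable_piecewise continuousOn_const hUm
  have hfC : ∀ x, |f x| ≤ C := by
    intro x
    by_cases hx : x ∈ interior K
    · rw [hf, Set.indicator_of_mem hx]; exact hC x (interior_subset hx)
    · rw [hf, Set.indicator_of_notMem hx, abs_zero]; exact hC0
  have hfinU : IsFiniteMeasure ((volume : Measure (Space (m + 1))).restrict (interior K)) :=
    ⟨by rw [Measure.restrict_apply_univ]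
        exact (h.bounded.subset interior_subset).measure_lt_top⟩
  have hfint : Integrable f := by
    refine (integrable_indicator_iff hUm).2 (Integrable.of_bound (C := C)
      ((hv.mono interior_subset).aestronglyMeasurable hUm) ?_)
    filter_upwards [ae_restrict_mem hUm] with x hx using hC x (interior_subset hx)
  have hDint : Integrable D :=
    (integrable_indicator_iff hUm).2 ((hG2.integrable one_le_two).inner_const ω)
  -- the contraction factors `1 - θ k` tend to one, and the mollification radii `ρ θ k / 2` are
  -- small compared with the distance of the contracted polytope from the boundary
  set θ : ℕ → ℝ := fun k => 2⁻¹ * (1 / ((k : ℝ) + 1)) with hθdef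
  have hθ0 : ∀ k, 0 < θ k := fun k => by simp only [hθdef]; positivity
  have hθ1 : ∀ k, θ k < 1 := by
    intro k
    have : 1 / ((k : ℝ) + 1) ≤ 1 := by
      rw [div_le_one (by positivity)]; linarith [(Nat.cast_nonneg k : (0 : ℝ) ≤ k)]
    simp only [hθdef]; linarith
  have hθt : Tendsto θ atTop (𝓝 0) := by
    simpa only [mul_zero] using
      (tendsto_one_div_add_atTop_nhds_zero_nat (𝕜 := ℝ)).const_mul (2⁻¹ : ℝ)
  set φ : ℕ → ContDiffBump (0 : Space (m + 1)) := fun k =>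
    ⟨θ k * ρ / 4, θ k * ρ / 2, by have := hθ0 k; positivity,
      by have := mul_pos (hθ0 k) hρ; linarith⟩ with hφdef
  have hφr : ∀ k, (φ k).rOut = θ k * ρ / 2 := fun k => rfl
  have hφt : Tendsto (fun k => (φ k).rOut) atTop (𝓝 0) := by
    simpa [hφr] using (hθt.mul_const ρ).div_const 2
  have hr : ∀ k, 0 < 1 - θ k := fun k => by linarith [hθ1 k]
  have hrt : Tendsto (fun k => 1 - θ k) atTop (𝓝 1) := by simpa using hθt.const_sub 1
  have hcr : ∀ k, ∀ x ∈ K,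
      Metric.closedBall (c + (1 - θ k) • (x - c)) (φ k).rOut ⊆ interior K := by
    intro k x hx
    have hsub : Metric.ball (c + (1 - θ k) • (x - c)) (θ k * ρ) ⊆ K := by
      intro z hz
      have hθk := hθ0 k
      set e := (θ k)⁻¹ • (z - (c + (1 - θ k) • (x - c))) with he
      have hce : c + e ∈ K := by
        refine interior_subset (hball ?_)
        rw [Metric.mem_ball, dist_eq_norm, add_sub_cancel_left, he, norm_smul, norm_inv,
          Real.norm_of_nonneg hθk.le, inv_mul_lt_iff₀ hθk, ← dist_eq_norm]
        exact hz
      have hz' : z = (1 - θ k) • x + θ k • (c + e) := by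
        rw [smul_add, he, smul_smul, mul_inv_cancel₀ hθk.ne', one_smul, smul_sub, sub_smul,
          sub_smul, one_smul, one_smul]
        abel
      rw [hz']
      exact h.convex hx hce (hr k).le hθk.le (by ring)
    refine (Metric.closedBall_subset_ball ?_).trans (interior_maximal hsub Metric.isOpen_ball)
    rw [hφr]; have := mul_pos (hθ0 k) hρ; linarith
  have hid := fun k => h.integral_mollify hω hG hfm hfC hfint hDint (φ k) c (hr k) (hcr k)
  -- limit of the volume integrals
  have hL : Tendsto (fun k => 2 * (1 - θ k) * |((1 - θ k) ^ (m + 1))⁻¹| * ∫ z, D z *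
      mollify (φ k) ({w | c + (1 - θ k)⁻¹ • (w - c) ∈ K}.indicator (mollify (φ k) f)) z) atTop
      (𝓝 (2 * ∫ z, D z * v z)) := by
    have hcoef : Tendsto (fun k => 2 * (1 - θ k) * |((1 - θ k) ^ (m + 1))⁻¹|) atTop (𝓝 2) := by
      have h1 : Tendsto (fun k => |((1 - θ k) ^ (m + 1))⁻¹|) atTop (𝓝 |((1 : ℝ) ^ (m + 1))⁻¹|) :=
        ((hrt.pow (m + 1)).inv₀ (by simp)).abs
      simpa using (hrt.const_mul 2).mul h1
    refine hcoef.mul ?_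
    have hgm : ∀ k, Measurable ({w | c + (1 - θ k)⁻¹ • (w - c) ∈ K}.indicator
        (mollify (φ k) f)) := by
      intro k
      refine Measurable.indicator ?_ (h.isClosed.preimage (by fun_prop)).measurableSet
      exact (contDiff_mollify (φ k) hfint.locallyIntegrable).continuous.measurable
    have hgC : ∀ k x, |{w | c + (1 - θ k)⁻¹ • (w - c) ∈ K}.indicator (mollify (φ k) f) x| ≤ C := by
      intro k x
      by_cases hx : x ∈ {w | c + (1 - θ k)⁻¹ • (w - c) ∈ K}
      · rw [Set.indicator_of_mem hx]
        exact abs_mollify_le _ hfm.aestronglyMeasurable hfC x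
      · rw [Set.indicator_of_notMem hx, abs_zero]; exact hC0
    refine tendsto_integral_of_dominated_convergence (fun z => C * |D z|) ?_
      (hDint.abs.const_mul C) ?_ ?_
    · intro k
      refine hDint.aestronglyMeasurable.mul ?_
      refine (contDiff_mollify (φ k) ?_).continuous.aestronglyMeasurable
      rw [← locallyIntegrableOn_univ]
      intro x _
      refine ⟨Metric.ball x 1, mem_nhdsWithin_of_mem_nhds (Metric.ball_mem_nhds x one_pos), ?_⟩
      have : IsFiniteMeasure ((volume : Measure (Space (m + 1))).restrict (Metric.ball x 1)) :=
        ⟨by rw [Measure.restrict_apply_univ]; exact Metric.isBounded_ball.measure_lt_top⟩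
      exact Integrable.of_bound (hgm k).aestronglyMeasurable C
        (Eventually.of_forall fun y => hgC k y)
    · intro k
      refine Eventually.of_forall fun z => ?_
      rw [Real.norm_eq_abs, abs_mul, mul_comm]
      gcongr
      exact abs_mollify_le _ (hgm k).aestronglyMeasurable (hgC k) z
    · refine Eventually.of_forall fun z => ?_
      by_cases hz : z ∈ interior K
      · refine Tendsto.const_mul _ ?_
        have hfz : Tendsto f (𝓝 z) (𝓝 (v z)) := by
          have h1 : Tendsto v (𝓝 z) (𝓝 (v z)) :=
            (hv.continuousAt (mem_interior_iff_mem_nhds.1 hz)).tendsto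
          refine h1.congr' ?_
          filter_upwards [isOpen_interior.mem_nhds hz] with w hw
          rw [hf, Set.indicator_of_mem hw]
        have h2 := tendsto_mollify hφt hfm.aestronglyMeasurable hfz
        refine ContDiffBump.convolution_tendsto_right hφt
          (Eventually.of_forall fun k => (hgm k).aestronglyMeasurable) ?_ tendsto_const_nhds
        refine h2.congr' ?_
        have h3 : Tendsto (fun p : ℕ × Space (m + 1) => c + (1 - θ p.1)⁻¹ • (p.2 - c))
            (atTop ×ˢ 𝓝 z) (𝓝 (c + (1 : ℝ)⁻¹ • (z - c))) := by
          refine Tendsto.const_add c (Tendsto.smul ?_ ?_)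
          · exact ((hrt.inv₀ one_ne_zero).comp tendsto_fst)
          · exact tendsto_snd.sub_const c
        rw [inv_one, one_smul, add_sub_cancel] at h3
        filter_upwards [h3.eventually (mem_interior_iff_mem_nhds.1 hz)] with p hp
        exact (Set.indicator_of_mem
          (show p.2 ∈ {w | c + (1 - θ p.1)⁻¹ • (w - c) ∈ K} from hp) _).symm
      · simp only [hDdef, Set.indicator_of_notMem hz, zero_mul]
        exact tendsto_const_nhds
  -- limit of the boundary integrals
  have hRt : Tendsto (fun k => ∫ x in frontier K, mollify (φ k) f (c + (1 - θ k) • (x - c)) ^ 2 *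
        inner ℝ ω (outwardNormal K x) ∂μHE[m]) atTop
      (𝓝 (∫ x in frontier K, v x ^ 2 * inner ℝ ω (outwardNormal K x) ∂μHE[m])) := by
    have hfin : IsFiniteMeasure ((μHE[m] : Measure (Space (m + 1))).restrict (frontier K)) :=
      ⟨by rw [Measure.restrict_apply_univ]; exact h.surfaceMeasure_frontier_lt_top⟩
    refine tendsto_integral_of_dominated_convergence (fun _ => C ^ 2) ?_
      (integrable_const _) ?_ ?_
    · intro k
      refine AEStronglyMeasurable.mul ?_ (h.aestronglyMeasurable_inner_outwardNormal ω _)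
      have := (contDiff_mollify (φ k) hfint.locallyIntegrable).continuous
      exact Continuous.aestronglyMeasurable (by fun_prop)
    · intro k
      refine Eventually.of_forall fun x => ?_
      rw [Real.norm_eq_abs, abs_mul, abs_pow]
      have h1 := abs_mollify_le (φ k) hfm.aestronglyMeasurable hfC (c + (1 - θ k) • (x - c))
      exact (mul_le_of_le_one_right (by positivity) (abs_inner_outwardNormal_le hω K x)).trans
        (by gcongr)
    · filter_upwards [ae_restrict_mem isClosed_frontier.measurableSet] with x hx
      refine Tendsto.mul_const _ (Tendsto.pow ?_ 2)
      rw [Metric.tendsto_atTop']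
      intro ε hε
      obtain ⟨δ, hδ, hδ'⟩ := Metric.continuousWithinAt_iff.1 (hv x (hfrK hx)) (ε / 2) (half_pos hε)
      have hsm : Tendsto (fun k => (φ k).rOut + θ k * dist x c) atTop (𝓝 0) := by
        simpa using hφt.add (hθt.mul_const (dist x c))
      obtain ⟨n, hn⟩ := eventually_atTop.1 (hsm.eventually_lt_const hδ)
      refine ⟨n, fun k hk => lt_of_le_of_lt ?_ (half_lt_self hε)⟩
      refine dist_mollify_le _ hfm.aestronglyMeasurable (half_pos hε).le fun z hz => ?_
      have hzU : z ∈ interior K := hcr k x (hfrK hx) (Metric.ball_subset_closedBall hz)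
      rw [hf, Set.indicator_of_mem hzU]
      refine (hδ' (interior_subset hzU) ?_).le
      refine lt_of_le_of_lt ?_ (hn k hk.le)
      refine (dist_triangle z (c + (1 - θ k) • (x - c)) x).trans (add_le_add (le_of_lt hz) ?_)
      have : c + (1 - θ k) • (x - c) - x = -(θ k • (x - c)) := by
        rw [sub_smul, one_smul]; abel
      rw [dist_eq_norm, this, norm_neg, norm_smul, Real.norm_of_nonneg (hθ0 k).le, dist_eq_norm]
  have hlim := tendsto_nhds_unique hL (hRt.congr fun k => (hid k).symm)
  rw [← hlim, ae_restrict_interior_eq h, ← integral_indicator hUm]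
  congr 1
  refine integral_congr_ae (Eventually.of_forall fun z => ?_)
  by_cases hz : z ∈ interior K
  · simp only [hDdef, Set.indicator_of_mem hz, real_inner_comm]
  · simp only [hDdef, Set.indicator_of_notMem hz, zero_mul]

end WeakDivergence

/-! ### Interfaces of a partition -/

section Mesh

open Filter Topology

lemma weakGrad_spec {d : ℕ} {U : Set (Space d)} {v : Space d → ℝ} (h : MemH1 U v) :
    IsWeakGradient U v (weakGrad U v) ∧ MemLp (weakGrad U v) 2 (volume.restrict U) := by
  rw [weakGrad, dif_pos h.2]
  exact h.2.choose_spec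

variable {d : ℕ} {X : Set (Space d)}

lemma MeshPartition.exists_isUnitRep (T : MeshPartition X) :
    ∃ N : Fin T.numElems → Finset (Space d × ℝ), ∀ j, IsUnitRep (N j) (T.elem j) := by
  choose N hN using fun j => (T.isConvexPolytope j).exists_isUnitRep
  exact ⟨N, hN⟩

lemma MeshPartition.elem_subset_closure (T : MeshPartition X) (j : Fin T.numElems) :
    T.elem j ⊆ closure X := T.iUnion_elem ▸ Set.subset_iUnion T.elem j

lemma MeshPartition.eq_of_mem_interior (T : MeshPartition X) {i j : Fin T.numElems} {x : Space d}
    (hi : x ∈ interior (T.elem i)) (hj : x ∈ interior (T.elem j)) : i = j := by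
  by_contra hij
  exact Set.disjoint_left.1 (T.disjoint_interior hij) hi hj

/-- Off the intersections of non-parallel face hyperplanes, an interface point belongs to exactly
two elements, whose outward normals there are opposite. -/
lemma MeshPartition.exists_neighbour (T : MeshPartition X) (hX : IsOpen X)
    {N : Fin T.numElems → Finset (Space d × ℝ)} (hN : ∀ j, IsUnitRep (N j) (T.elem j))
    {x : Space d} (hxX : x ∈ X)
    (hx : ∀ i j, ∀ p ∈ N i, ∀ q ∈ N j, inner ℝ p.1 x = p.2 → inner ℝ q.1 x = q.2 →
      q.1 = p.1 ∨ q.1 = -p.1)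
    {j : Fin T.numElems} (hj : x ∈ frontier (T.elem j)) :
    ∃ i, i ≠ j ∧ x ∈ frontier (T.elem i) ∧
      outwardNormal (T.elem i) x = -outwardNormal (T.elem j) x ∧
      ∀ k, x ∈ T.elem k → k = i ∨ k = j := by
  have hfacet : ∀ k, x ∈ frontier (T.elem k) → ∃ q ∈ N k, x ∈ facet (N k) (T.elem k) q := by
    intro k hk
    rcases (hN k).mem_facet_or hk with h | ⟨p, hp, q, hq, hpx, hqx, hqp⟩
    · exact h
    · rcases hx k k p hp q hq hpx hqx with h | h
      · exact absurd h hqp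
      · exact absurd h ((hN k).ne_neg_of_active hp hq hpx hqx)
  obtain ⟨p, hp, hxp⟩ := hfacet j hj
  have hin := (hN j).eventually_sub_smul_mem_interior hp hxp
  have htend : Tendsto (fun ε : ℝ => x - ε • p.1) (𝓝[>] 0) (𝓝 x) := by
    have : Continuous fun ε : ℝ => x - ε • p.1 := by fun_prop
    simpa using (this.tendsto 0).mono_left nhdsWithin_le_nhds
  -- any other element containing the point touches it with a facet of opposite normal
  have hother : ∀ k, x ∈ T.elem k → k ≠ j →
      x ∈ frontier (T.elem k) ∧ ∃ q ∈ N k, x ∈ facet (N k) (T.elem k) q ∧ q.1 = -p.1 := by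
    intro k hk hkj
    have hfr : x ∈ frontier (T.elem k) := by
      rw [(hN k).isClosed.frontier_eq]
      refine ⟨hk, fun hint => hkj ?_⟩
      obtain ⟨ε, h1, h2⟩ := (hin.and (htend.eventually (isOpen_interior.mem_nhds hint))).exists
      exact T.eq_of_mem_interior h2 h1
    obtain ⟨q, hq, hxq⟩ := hfacet k hfr
    refine ⟨hfr, q, hq, hxq, ?_⟩
    rcases hx j k p hp q hq hxp.2.1 hxq.2.1 with h | h
    · refine absurd ?_ hkj
      obtain ⟨ε, h1, h2⟩ := (hin.and ((hN k).eventually_sub_smul_mem_interior hq hxq)).exists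
      rw [h] at h2
      exact T.eq_of_mem_interior h2 h1
    · exact h
  -- the points just outside the element are covered by some other element
  obtain ⟨i, hij, hi⟩ : ∃ i, i ≠ j ∧ x ∈ T.elem i := by
    have htend' : Tendsto (fun ε : ℝ => x + ε • p.1) (𝓝[>] 0) (𝓝 x) := by
      have : Continuous fun ε : ℝ => x + ε • p.1 := by fun_prop
      simpa using (this.tendsto 0).mono_left nhdsWithin_le_nhds
    by_contra! hno
    have hfar : ∀ i, ∀ᶠ ε : ℝ in 𝓝[>] 0, x + ε • p.1 ∉ T.elem i := by
      intro i
      by_cases hij : i = j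
      · subst hij
        filter_upwards [self_mem_nhdsWithin] with ε hε hmem
        have h1 := ((hN i).mem_iff _).1 hmem p hp
        rw [inner_add_right, inner_smul_right, hxp.2.1, (hN i).inner_self_eq_one hp] at h1
        have hε : (0 : ℝ) < ε := hε
        linarith
      · exact htend'.eventually ((hN i).isClosed.isOpen_compl.mem_nhds (hno i hij))
    obtain ⟨ε, h1, h2⟩ :=
      ((eventually_all.2 hfar).and (htend'.eventually (hX.mem_nhds hxX))).exists
    have h3 : x + ε • p.1 ∈ ⋃ k, T.elem k := by rw [T.iUnion_elem]; exact subset_closure h2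
    obtain ⟨k, hk⟩ := Set.mem_iUnion.1 h3
    exact h1 k hk
  obtain ⟨hfri, q, hq, hxq, hqp⟩ := hother i hi hij
  refine ⟨i, hij, hfri, ?_, fun k hk => ?_⟩
  · rw [(hN i).outwardNormal_of_mem_facet hq hxq, (hN j).outwardNormal_of_mem_facet hp hxp, hqp]
  · by_cases hkj : k = j
    · exact Or.inr hkj
    · left
      obtain ⟨-, q', hq', hxq', hqp'⟩ := hother k hk hkj
      obtain ⟨ε, h1, h2⟩ := (((hN i).eventually_sub_smul_mem_interior hq hxq).and
        ((hN k).eventually_sub_smul_mem_interior hq' hxq')).exists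
      rw [hqp'] at h2
      rw [hqp] at h1
      exact T.eq_of_mem_interior h2 h1

lemma upwindTrace_eq_zero (T : MeshPartition X) (w : BrokenFun T) (j : Fin T.numElems)
    {x : Space d} (hx : x ∈ frontier X) : upwindTrace T w j x = 0 := if_pos hx

lemma upwindTrace_eq (T : MeshPartition X) (w : BrokenFun T) {i j : Fin T.numElems} {x : Space d}
    (hx : x ∉ frontier X) (hij : i ≠ j) (hi : x ∈ T.elem i)
    (hk : ∀ k, x ∈ T.elem k → k = i ∨ k = j) : upwindTrace T w j x = w i x := by
  classical
  rw [upwindTrace, if_neg hx, Finset.sum_eq_single i]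
  · exact Set.indicator_of_mem hi _
  · intro k hkj hki
    refine Set.indicator_of_notMem (fun hmem => ?_) _
    rcases hk k hmem with h | h
    · exact hki h
    · exact Finset.ne_of_mem_erase hkj h
  · intro h
    exact absurd (Finset.mem_erase.2 ⟨hij, Finset.mem_univ i⟩) h

/-- At an interface point of exactly two elements, the incoming flux of the upwind traces is the
outgoing flux of the traces from inside. -/
lemma MeshPartition.flux_pointwise (T : MeshPartition X) (hX : IsOpen X)
    {N : Fin T.numElems → Finset (Space d × ℝ)} (hN : ∀ j, IsUnitRep (N j) (T.elem j))
    (ω : Space d) (w : BrokenFun T) {x : Space d}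
    (hx : ∀ i j, ∀ p ∈ N i, ∀ q ∈ N j, inner ℝ p.1 x = p.2 → inner ℝ q.1 x = q.2 →
      q.1 = p.1 ∨ q.1 = -p.1) :
    ∑ j, (inflow ω (T.elem j)).indicator
        (fun x => upwindTrace T w j x ^ 2 * inner ℝ ω (outwardNormal (T.elem j) x)) x =
      -∑ j, (outflow ω (T.elem j) \ frontier X).indicator
        (fun x => w j x ^ 2 * inner ℝ ω (outwardNormal (T.elem j) x)) x := by
  by_cases hxX : x ∈ X
  · have hxf : x ∉ frontier X := fun h => by
      rw [hX.frontier_eq] at h; exact h.2 hxX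
    by_cases hfr : ∃ j, x ∈ frontier (T.elem j) ∧ inner ℝ ω (outwardNormal (T.elem j) x) ≠ 0
    · -- name the two elements such that `ω` points out of `i` and into `j`
      obtain ⟨i, j, hij, hi, hj, hn, hpos, hk⟩ : ∃ i j, i ≠ j ∧ x ∈ frontier (T.elem i) ∧
          x ∈ frontier (T.elem j) ∧
          outwardNormal (T.elem i) x = -outwardNormal (T.elem j) x ∧
          inner ℝ ω (outwardNormal (T.elem j) x) < 0 ∧
          ∀ k, x ∈ T.elem k → k = i ∨ k = j := by
        obtain ⟨j, hj, hne⟩ := hfr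
        obtain ⟨i, hij, hi, hn, hk⟩ := T.exists_neighbour hX hN hxX hx hj
        rcases lt_or_gt_of_ne hne with h0 | h0
        · exact ⟨i, j, hij, hi, hj, hn, h0, hk⟩
        · refine ⟨j, i, hij.symm, hj, hi, by rw [hn, neg_neg], ?_, fun k h => (hk k h).symm⟩
          rw [hn, inner_neg_right]; linarith
      have hiK : x ∈ T.elem i := (hN i).isClosed.frontier_subset hi
      have hout : 0 < inner ℝ ω (outwardNormal (T.elem i) x) := by
        rw [hn, inner_neg_right]; linarith
      rw [Finset.sum_eq_single j, Finset.sum_eq_single i,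
        Set.indicator_of_mem (show x ∈ inflow ω (T.elem j) from ⟨hj, hpos⟩),
        Set.indicator_of_mem (show x ∈ outflow ω (T.elem i) \ frontier X from
          ⟨⟨hi, hout.le⟩, hxf⟩), upwindTrace_eq T w hxf hij hiK hk, hn, inner_neg_right]
      · ring
      · intro k _ hki
        refine Set.indicator_of_notMem (fun hmem => ?_) _
        rcases hk k ((hN k).isClosed.frontier_subset hmem.1.1) with h | h
        · exact hki h
        · rw [h] at hmem; exact absurd hmem.1.2 (not_le.2 hpos)
      · exact fun h => absurd (Finset.mem_univ i) h
      · intro k _ hkj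
        refine Set.indicator_of_notMem (fun hmem => ?_) _
        rcases hk k ((hN k).isClosed.frontier_subset hmem.1) with h | h
        · rw [h] at hmem; exact absurd hmem.2 (not_lt.2 hout.le)
        · exact hkj h
      · exact fun h => absurd (Finset.mem_univ j) h
    · push Not at hfr
      rw [Finset.sum_eq_zero, Finset.sum_eq_zero, neg_zero]
      · intro k _
        by_cases hmem : x ∈ outflow ω (T.elem k) \ frontier X
        · rw [Set.indicator_of_mem hmem, hfr k hmem.1.1, mul_zero]
        · exact Set.indicator_of_notMem hmem _
      · intro k _
        by_cases hmem : x ∈ inflow ω (T.elem k)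
        · rw [Set.indicator_of_mem hmem, hfr k hmem.1, mul_zero]
        · exact Set.indicator_of_notMem hmem _
  · have hfr : ∀ j, x ∈ frontier (T.elem j) → x ∈ frontier X := by
      intro j hj
      rw [hX.frontier_eq]
      exact ⟨T.elem_subset_closure j ((hN j).isClosed.frontier_subset hj), hxX⟩
    rw [Finset.sum_eq_zero, Finset.sum_eq_zero, neg_zero]
    · intro k _
      exact Set.indicator_of_notMem (fun hmem => hmem.2 (hfr k hmem.1.1)) _
    · intro k _
      by_cases hmem : x ∈ inflow ω (T.elem k)
      · rw [Set.indicator_of_mem hmem, upwindTrace_eq_zero T w k (hfr k hmem.1)]; simp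
      · exact Set.indicator_of_notMem hmem _

lemma IsUnitRep.measurable_indicator {N : Finset (Space d × ℝ)} {K : Set (Space d)}
    (h : IsUnitRep N K) {v : Space d → ℝ} (hv : ContinuousOn v K) :
    Measurable (K.indicator v) := by
  classical
  rw [← Set.piecewise_eq_indicator]
  exact hv.measurable_piecewise continuousOn_const h.isClosed.measurableSet

lemma IsUnitRep.exists_bound {N : Finset (Space d × ℝ)} {K : Set (Space d)}
    (h : IsUnitRep N K) {v : Space d → ℝ} (hv : ContinuousOn v K) :
    ∃ C, 0 ≤ C ∧ ∀ x ∈ K, |v x| ≤ C := by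
  obtain ⟨C, hC⟩ := h.isCompact.exists_bound_of_continuousOn hv
  exact ⟨|C|, abs_nonneg C, fun x hx => (hC x hx).trans (le_abs_self C)⟩

lemma measurable_upwindTrace (T : MeshPartition X) {w : BrokenFun T}
    (hw : ∀ i, ContinuousOn (w i) (T.elem i)) (j : Fin T.numElems) :
    Measurable (upwindTrace T w j) := by
  classical
  obtain ⟨N, hN⟩ := T.exists_isUnitRep
  refine Measurable.ite isClosed_frontier.measurableSet measurable_const ?_
  exact Finset.measurable_sum _ fun i _ => (hN i).measurable_indicator (hw i)

lemma exists_bound_upwindTrace (T : MeshPartition X) {w : BrokenFun T}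
    (hw : ∀ i, ContinuousOn (w i) (T.elem i)) (j : Fin T.numElems) :
    ∃ C, ∀ x, |upwindTrace T w j x| ≤ C := by
  classical
  obtain ⟨N, hN⟩ := T.exists_isUnitRep
  choose C hC0 hC using fun i => (hN i).exists_bound (hw i)
  refine ⟨∑ i ∈ Finset.univ.erase j, C i, fun x => ?_⟩
  by_cases hx : x ∈ frontier X
  · rw [upwindTrace_eq_zero T w j hx, abs_zero]
    exact Finset.sum_nonneg fun i _ => hC0 i
  · rw [upwindTrace, if_neg hx]
    refine (Finset.abs_sum_le_sum_abs _ _).trans (Finset.sum_le_sum fun i _ => ?_)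
    by_cases hi : x ∈ T.elem i
    · rw [Set.indicator_of_mem hi]; exact hC i x hi
    · rw [Set.indicator_of_notMem hi, abs_zero]; exact hC0 i

end Mesh

/-! ### The upwind energy identity -/

section Upwind

open Filter

variable {m : ℕ} {X : Set (Space (m + 1))}

/-- Almost every point, for the surface measure, lies on no intersection of non-parallel face
hyperplanes. -/
lemma MeshPartition.ae_parallel (T : MeshPartition X)
    {N : Fin T.numElems → Finset (Space (m + 1) × ℝ)} (hN : ∀ j, IsUnitRep (N j) (T.elem j)) :
    ∀ᵐ x ∂(μHE[m] : Measure (Space (m + 1))), ∀ i j, ∀ p ∈ N i, ∀ q ∈ N j,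
      inner ℝ p.1 x = p.2 → inner ℝ q.1 x = q.2 → q.1 = p.1 ∨ q.1 = -p.1 := by
  refine ae_all_iff.2 fun i => ae_all_iff.2 fun j => ?_
  refine (eventually_all_finset (N i)).2 fun p hp => (eventually_all_finset (N j)).2 fun q hq => ?_
  by_cases hpq : q.1 = p.1 ∨ q.1 = -p.1
  · exact Eventually.of_forall fun _ _ _ => hpq
  · push Not at hpq
    filter_upwards [measure_eq_zero_iff_ae_notMem.1 (surfaceMeasure_inter_hyperplanes (m := m)
      (by simp) ((hN i).unit p hp) ((hN j).unit q hq) hpq.1 hpq.2 p.2 q.2)] with x hx h1 h2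
    exact absurd ⟨h1, h2⟩ hx

/-- The upwind traces carry into the elements what the neighbouring elements send out. -/
lemma MeshPartition.sum_integral_upwindTrace (T : MeshPartition X) (hX : IsOpen X)
    {ω : Space (m + 1)} (hω : ‖ω‖ = 1) {w : BrokenFun T}
    (hw : ∀ i, ContinuousOn (w i) (T.elem i)) :
    ∑ j, ∫ x in inflow ω (T.elem j),
        upwindTrace T w j x ^ 2 * inner ℝ ω (outwardNormal (T.elem j) x) ∂μHE[m] =
      -∑ j, ∫ x in outflow ω (T.elem j) \ frontier X,
        w j x ^ 2 * inner ℝ ω (outwardNormal (T.elem j) x) ∂μHE[m] := by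
  obtain ⟨N, hN⟩ := T.exists_isUnitRep
  have hXm : MeasurableSet (frontier X) := isClosed_frontier.measurableSet
  have hin := fun j => (hN j).measurableSet_inflow ω
  have hout := fun j => ((hN j).measurableSet_outflow ω).diff hXm
  have hI1 : ∀ j, IntegrableOn (fun x => upwindTrace T w j x ^ 2 *
      inner ℝ ω (outwardNormal (T.elem j) x)) (inflow ω (T.elem j)) μHE[m] := by
    intro j
    obtain ⟨C, hC⟩ := exists_bound_upwindTrace T hw j
    refine ((hN j).integrableOn_frontier hω (C := C ^ 2)
      ((measurable_upwindTrace T hw j).pow_const 2).aestronglyMeasurable fun x _ => ?_).mono_set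
      (inflow_subset_frontier ω _)
    rw [abs_pow]
    exact pow_le_pow_left₀ (abs_nonneg _) (hC x) 2
  have hI2 : ∀ j, IntegrableOn (fun x => w j x ^ 2 *
      inner ℝ ω (outwardNormal (T.elem j) x)) (outflow ω (T.elem j) \ frontier X) μHE[m] := by
    intro j
    obtain ⟨C, hC0, hC⟩ := (hN j).exists_bound (hw j)
    have hfr := (hN j).isClosed.frontier_subset
    refine ((hN j).integrableOn_frontier hω (C := C ^ 2)
      (((hw j).mono hfr).pow 2 |>.aestronglyMeasurable isClosed_frontier.measurableSet)
      fun x hx => ?_).mono_set (Set.sdiff_subset.trans (outflow_subset_frontier ω _))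
    rw [Pi.pow_apply, abs_pow]
    exact pow_le_pow_left₀ (abs_nonneg _) (hC x (hfr hx)) 2
  simp_rw [← integral_indicator (hin _), ← integral_indicator (hout _)]
  rw [← integral_finsetSum _ fun j _ => (integrable_indicator_iff (hin j)).2 (hI1 j),
    ← integral_finsetSum _ fun j _ => (integrable_indicator_iff (hout j)).2 (hI2 j),
    ← integral_neg]
  refine integral_congr_ae ?_
  filter_upwards [T.ae_parallel hN] with x hx
  exact T.flux_pointwise hX hN ω w hx

/-- The energy identity of the upwind discretisation of `ω · ∇`: the volume terms and the jump
terms of the bilinear form add up to half the squared jumps and half the outgoing boundary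
values. -/
theorem MeshPartition.upwind_identity (T : MeshPartition X) (hX : IsOpen X)
    {ω : Space (m + 1)} (hω : ‖ω‖ = 1) {w : BrokenFun T} (hw : MemBroken T w) :
    2 * (∑ j, ∫ x in T.elem j, dirDeriv T ω w j x * w j x) +
      2 * (∑ j, ∫ x in inflow ω (T.elem j), jump T w j x *
        (w j x * |inner ℝ ω (outwardNormal (T.elem j) x)|) ∂μHE[m]) =
    (∑ j, ∫ x in inflow ω (T.elem j), jump T w j x *
        (jump T w j x * |inner ℝ ω (outwardNormal (T.elem j) x)|) ∂μHE[m]) +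
      ∑ j, ∫ x in outflow ω (T.elem j) ∩ frontier X,
        w j x * (w j x * inner ℝ ω (outwardNormal (T.elem j) x)) ∂μHE[m] := by
  obtain ⟨N, hN⟩ := T.exists_isUnitRep
  have hXm : MeasurableSet (frontier X) := isClosed_frontier.measurableSet
  have hupw := T.sum_integral_upwindTrace hX hω fun i => (hw i).1
  set μ : Measure (Space (m + 1)) := μHE[m]
  set f : Fin T.numElems → Space (m + 1) → ℝ := fun j x => inner ℝ ω (outwardNormal (T.elem j) x)
  have hkey : ∀ j, 2 * (∫ x in T.elem j, dirDeriv T ω w j x * w j x) +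
      2 * (∫ x in inflow ω (T.elem j), jump T w j x * (w j x * |f j x|) ∂μ) =
      (∫ x in inflow ω (T.elem j), jump T w j x * (jump T w j x * |f j x|) ∂μ) +
      (∫ x in outflow ω (T.elem j) ∩ frontier X, w j x * (w j x * f j x) ∂μ) +
      ((∫ x in inflow ω (T.elem j), upwindTrace T w j x ^ 2 * f j x ∂μ) +
        ∫ x in outflow ω (T.elem j) \ frontier X, w j x ^ 2 * f j x ∂μ) := by
    intro j
    have hfr := (hN j).isClosed.frontier_subset
    have hin := (hN j).measurableSet_inflow ω
    have hout := (hN j).measurableSet_outflow ω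
    have hwm : AEStronglyMeasurable (w j) (μ.restrict (frontier (T.elem j))) :=
      ((hw j).1.mono hfr).aestronglyMeasurable isClosed_frontier.measurableSet
    have hum : AEStronglyMeasurable (upwindTrace T w j) (μ.restrict (frontier (T.elem j))) :=
      (measurable_upwindTrace T (fun i => (hw i).1) j).aestronglyMeasurable
    obtain ⟨C, hC0, hC⟩ := (hN j).exists_bound (hw j).1
    obtain ⟨C', hC'⟩ := exists_bound_upwindTrace T (fun i => (hw i).1) j
    have hC'0 : 0 ≤ C' := (abs_nonneg _).trans (hC' 0)
    have hww : IntegrableOn (fun x => w j x ^ 2 * f j x) (frontier (T.elem j)) μ :=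
      (hN j).integrableOn_frontier hω (C := C ^ 2) (hwm.pow 2) fun x hx => by
        rw [abs_pow]; exact pow_le_pow_left₀ (abs_nonneg _) (hC x (hfr hx)) 2
    have huu : IntegrableOn (fun x => upwindTrace T w j x ^ 2 * f j x) (frontier (T.elem j)) μ :=
      (hN j).integrableOn_frontier hω (C := C' ^ 2) (hum.pow 2) fun x hx => by
        rw [abs_pow]; exact pow_le_pow_left₀ (abs_nonneg _) (hC' x) 2
    have huw : IntegrableOn (fun x => (upwindTrace T w j x * w j x) * f j x)
        (frontier (T.elem j)) μ :=
      (hN j).integrableOn_frontier hω (C := C' * C) (hum.mul hwm) fun x hx => by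
        rw [abs_mul]; exact mul_le_mul (hC' x) (hC x (hfr hx)) (abs_nonneg _) hC'0
    have hww' := hww.mono_set (inflow_subset_frontier ω _)
    have huu' := huu.mono_set (inflow_subset_frontier ω _)
    have huw' := huw.mono_set (inflow_subset_frontier ω _)
    have habs : ∀ x ∈ inflow ω (T.elem j), |f j x| = -f j x := fun x hx => abs_of_neg hx.2
    have hvol : 2 * (∫ x in T.elem j, dirDeriv T ω w j x * w j x) =
        ∫ x in frontier (T.elem j), w j x ^ 2 * f j x ∂μ :=
      (hN j).integral_mul_weakGradient hω (hw j).1 (weakGrad_spec (hw j).2).1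
        (weakGrad_spec (hw j).2).2
    have hsplit : ∫ x in frontier (T.elem j), w j x ^ 2 * f j x ∂μ =
        (∫ x in inflow ω (T.elem j), w j x ^ 2 * f j x ∂μ) +
        ((∫ x in outflow ω (T.elem j) ∩ frontier X, w j x ^ 2 * f j x ∂μ) +
          ∫ x in outflow ω (T.elem j) \ frontier X, w j x ^ 2 * f j x ∂μ) := by
      have hun : frontier (T.elem j) = inflow ω (T.elem j) ∪ outflow ω (T.elem j) := by
        ext x
        simp only [inflow, outflow, Set.mem_union, Set.mem_ofPred_eq]
        have := lt_or_ge (inner ℝ ω (outwardNormal (T.elem j) x)) 0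
        tauto
      have hdis : Disjoint (inflow ω (T.elem j)) (outflow ω (T.elem j)) :=
        Set.disjoint_left.2 fun x h1 h2 => absurd h1.2 (not_lt.2 h2.2)
      have hww'' := hww.mono_set (outflow_subset_frontier ω _)
      rw [integral_inter_add_sdiff hXm hww'', ← setIntegral_union hdis hout hww' hww'', ← hun]
    have e1 : ∫ x in inflow ω (T.elem j), jump T w j x * (w j x * |f j x|) ∂μ =
        (∫ x in inflow ω (T.elem j), (upwindTrace T w j x * w j x) * f j x ∂μ) -
          ∫ x in inflow ω (T.elem j), w j x ^ 2 * f j x ∂μ := by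
      rw [← integral_sub huw' hww']
      refine setIntegral_congr_fun hin fun x hx => ?_
      simp only [habs x hx, jump]; ring
    have e2 : ∫ x in inflow ω (T.elem j), jump T w j x * (jump T w j x * |f j x|) ∂μ =
        2 * (∫ x in inflow ω (T.elem j), (upwindTrace T w j x * w j x) * f j x ∂μ) -
          ((∫ x in inflow ω (T.elem j), w j x ^ 2 * f j x ∂μ) +
          ∫ x in inflow ω (T.elem j), upwindTrace T w j x ^ 2 * f j x ∂μ) := by
      have hsum : IntegrableOn (fun x => w j x ^ 2 * f j x + upwindTrace T w j x ^ 2 * f j x)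
          (inflow ω (T.elem j)) μ := hww'.add huu'
      rw [← integral_add hww' huu', ← integral_const_mul, ← integral_sub (huw'.const_mul 2) hsum]
      refine setIntegral_congr_fun hin fun x hx => ?_
      simp only [habs x hx, jump]; ring
    have e3 : ∫ x in outflow ω (T.elem j) ∩ frontier X, w j x * (w j x * f j x) ∂μ =
        ∫ x in outflow ω (T.elem j) ∩ frontier X, w j x ^ 2 * f j x ∂μ := by
      congr 1; funext x; ring
    rw [hvol, hsplit, e1, e2, e3]
    ring
  rw [Finset.mul_sum, Finset.mul_sum, ← Finset.sum_add_distrib, Finset.sum_congr rfl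
    fun j _ => hkey j, Finset.sum_add_distrib, Finset.sum_add_distrib, Finset.sum_add_distrib,
    hupw, neg_add_cancel, add_zero]

end Upwind

/-! ### Coercivity of the volume terms -/

section Coercivity

/-- Schur-type bound for a symmetric nonnegative kernel with weighted row sums at most `s`. -/
lemma scattering_le {ι : Type*} [Fintype ι] {w : ι → ℝ} {a : ι → ι → ℝ} {s α β : ℝ}
    (hw : ∀ l, 0 < w l) (ha : ∀ l i, 0 ≤ a l i) (hsymm : ∀ l i, a l i = a i l)
    (hs : ∀ l, ∑ i, w i * a l i ≤ s) (hα : 0 < α) (hβ : 0 < β) (hαβ : 4 * α * β = 1)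
    (x y : ι → ℝ) :
    ∑ l, w l * ((∑ i, w i * a l i * x i) * y l) ≤
      s * (α * ∑ l, w l * x l ^ 2 + β * ∑ l, w l * y l ^ 2) := by
  have h1 : ∀ l i, x i * y l ≤ α * x i ^ 2 + β * y l ^ 2 := by
    intro l i
    have h4 : β = 1 / (4 * α) := by field_simp; linarith
    have h5 : α * x i ^ 2 + β * y l ^ 2 - x i * y l = α * (x i - y l / (2 * α)) ^ 2 := by
      rw [h4]; field_simp; ring
    have h6 : 0 ≤ α * (x i - y l / (2 * α)) ^ 2 := by positivity
    linarith
  have hrow : ∀ z : ι → ℝ, ∑ l, ∑ i, w l * w i * a l i * z l ^ 2 ≤ s * ∑ l, w l * z l ^ 2 := by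
    intro z
    rw [Finset.mul_sum]
    refine Finset.sum_le_sum fun l _ => ?_
    have : ∑ i, w l * w i * a l i * z l ^ 2 = (∑ i, w i * a l i) * (w l * z l ^ 2) := by
      rw [Finset.sum_mul]; exact Finset.sum_congr rfl fun i _ => by ring
    rw [this]
    exact mul_le_mul_of_nonneg_right (hs l) (mul_nonneg (hw l).le (sq_nonneg _))
  have hcol : ∑ l, ∑ i, w l * w i * a l i * x i ^ 2 = ∑ l, ∑ i, w l * w i * a l i * x l ^ 2 := by
    rw [Finset.sum_comm]
    refine Finset.sum_congr rfl fun l _ => Finset.sum_congr rfl fun i _ => ?_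
    rw [hsymm i l]; ring
  calc ∑ l, w l * ((∑ i, w i * a l i * x i) * y l)
      = ∑ l, ∑ i, w l * w i * a l i * (x i * y l) := by
        refine Finset.sum_congr rfl fun l _ => ?_
        rw [Finset.sum_mul, Finset.mul_sum]
        exact Finset.sum_congr rfl fun i _ => by ring
    _ ≤ ∑ l, ∑ i, w l * w i * a l i * (α * x i ^ 2 + β * y l ^ 2) := by
        refine Finset.sum_le_sum fun l _ => Finset.sum_le_sum fun i _ => ?_
        exact mul_le_mul_of_nonneg_left (h1 l i)
          (mul_nonneg (mul_nonneg (hw l).le (hw i).le) (ha l i))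
    _ = α * ∑ l, ∑ i, w l * w i * a l i * x i ^ 2 + β * ∑ l, ∑ i, w l * w i * a l i * y l ^ 2 := by
        simp only [Finset.mul_sum, ← Finset.sum_add_distrib]
        exact Finset.sum_congr rfl fun l _ => Finset.sum_congr rfl fun i _ => by ring
    _ ≤ α * (s * ∑ l, w l * x l ^ 2) + β * (s * ∑ l, w l * y l ^ 2) := by
        rw [hcol]
        exact add_le_add (mul_le_mul_of_nonneg_left (hrow x) hα.le)
          (mul_le_mul_of_nonneg_left (hrow y) hβ.le)
    _ = _ := by ring

/-- The coercivity of the volume terms at a single point. The coefficient of `u l ^ 2` after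
absorbing the streamline terms is `3 (c - 2 δ M²)`, which is at least `c` once `3 δ M² ≤ c`. -/
lemma coercivity_pointwise {ι : Type*} [Fintype ι] {w : ι → ℝ} {a : ι → ι → ℝ}
    {s σ c M δ : ℝ} (hw : ∀ l, 0 < w l) (ha : ∀ l i, 0 ≤ a l i) (hsymm : ∀ l i, a l i = a i l)
    (hs : ∀ l, ∑ i, w i * a l i ≤ s) (hs0 : 0 ≤ s) (hc : 0 < c) (hcs : c ≤ σ - s) (hM : 1 ≤ M)
    (hσM : |σ| ≤ M) (hδ : 0 ≤ δ) (hδM : 3 * δ * M ^ 2 ≤ c) (u D : ι → ℝ) :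
    ∑ l, w l * (c * u l ^ 2 + δ * D l ^ 2 + 3 * (D l * u l)) ≤
      ∑ l, w l * (3 * ((D l + σ * u l) * (u l + δ * D l) -
        (∑ i, w i * a l i * u i) * (u l + δ * D l))) := by
  set S : ι → ℝ := fun l => ∑ i, w i * a l i * u i with hS
  have hM0 : 0 < M := by linarith
  have hsM : s ≤ M := by linarith [le_abs_self σ]
  set U := ∑ l, w l * u l ^ 2 with hU
  set V := ∑ l, w l * D l ^ 2 with hV
  have hU0 : 0 ≤ U := Finset.sum_nonneg fun l _ => mul_nonneg (hw l).le (sq_nonneg _)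
  have hV0 : 0 ≤ V := Finset.sum_nonneg fun l _ => mul_nonneg (hw l).le (sq_nonneg _)
  have h1 : ∑ l, w l * (S l * u l) ≤ s * U := by
    have := scattering_le hw ha hsymm hs (α := 1 / 2) (β := 1 / 2) (by norm_num) (by norm_num)
      (by norm_num) u u
    refine this.trans (le_of_eq ?_)
    rw [hU]; ring
  have h2 : ∑ l, w l * (S l * D l) ≤ M ^ 2 * U + 1 / 4 * V := by
    have := scattering_le hw ha hsymm hs (α := M) (β := 1 / (4 * M)) hM0 (by positivity)
      (by field_simp) u D
    refine this.trans ?_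
    calc s * (M * U + 1 / (4 * M) * V) ≤ M * (M * U + 1 / (4 * M) * V) := by gcongr
      _ = M ^ 2 * U + 1 / 4 * V := by field_simp
  have h3 : ∑ l, w l * (-(σ * u l * D l)) ≤ M ^ 2 * U + 1 / 4 * V := by
    rw [hU, hV, Finset.mul_sum, Finset.mul_sum, ← Finset.sum_add_distrib]
    refine Finset.sum_le_sum fun l _ => ?_
    have hσ2 : σ ^ 2 ≤ M ^ 2 := sq_le_sq' (by linarith [neg_abs_le σ]) (by linarith [le_abs_self σ])
    have h4 : -(σ * u l * D l) ≤ M ^ 2 * u l ^ 2 + 1 / 4 * D l ^ 2 := by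
      nlinarith [sq_nonneg (σ * u l + D l / 2), mul_le_mul_of_nonneg_right hσ2 (sq_nonneg (u l))]
    calc w l * (-(σ * u l * D l)) ≤ w l * (M ^ 2 * u l ^ 2 + 1 / 4 * D l ^ 2) :=
          mul_le_mul_of_nonneg_left h4 (hw l).le
      _ = _ := by ring
  have hR : ∑ l, w l * (3 * ((D l + σ * u l) * (u l + δ * D l) - S l * (u l + δ * D l))) =
      3 * (∑ l, w l * (D l * u l)) + 3 * σ * U + 3 * δ * V - 3 * (∑ l, w l * (S l * u l)) -
        3 * δ * (∑ l, w l * (-(σ * u l * D l))) - 3 * δ * ∑ l, w l * (S l * D l) := by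
    rw [hU, hV]
    simp only [Finset.mul_sum, ← Finset.sum_add_distrib, ← Finset.sum_sub_distrib]
    exact Finset.sum_congr rfl fun l _ => by ring
  have hL : ∑ l, w l * (c * u l ^ 2 + δ * D l ^ 2 + 3 * (D l * u l)) =
      c * U + δ * V + 3 * ∑ l, w l * (D l * u l) := by
    rw [hU, hV]
    simp only [Finset.mul_sum, ← Finset.sum_add_distrib]
    exact Finset.sum_congr rfl fun l _ => by ring
  rw [hR, hL]
  have h5 := mul_le_mul_of_nonneg_left h2 hδ
  have h6 := mul_le_mul_of_nonneg_left h3 hδ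
  have h7 := mul_le_mul_of_nonneg_right hcs hU0
  have h8 := mul_le_mul_of_nonneg_right hδM hU0
  have h9 := mul_nonneg hδ hV0
  nlinarith

lemma memLp_top_ae_bound {α : Type*} [MeasurableSpace α] {μ : Measure α} {f : α → ℝ}
    (hf : MemLp f ⊤ μ) : ∃ M, 1 ≤ M ∧ ∀ᵐ x ∂μ, |f x| ≤ M := by
  refine ⟨max 1 (eLpNorm f ⊤ μ).toReal, le_max_left _ _, ?_⟩
  filter_upwards [enorm_ae_le_eLpNormEssSup f μ] with x hx
  refine le_trans ?_ (le_max_right _ _)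
  rw [eLpNorm_exponent_top, ← Real.norm_eq_abs, ← toReal_enorm]
  refine ENNReal.toReal_mono ?_ hx
  rw [← eLpNorm_exponent_top]; exact hf.2.ne

/-- The coercivity of the volume terms on an element, for functions and coefficients on an abstract
measure space. -/
lemma coercivity_integral {α ι : Type*} [MeasurableSpace α] [Fintype ι] {μ : Measure α}
    {w : ι → ℝ} {σt σs s : α → ℝ} {k : ι → ι → α → ℝ} {c M δ : ℝ}
    (hw : ∀ l, 0 < w l) (hc : 0 < c) (hM : 1 ≤ M) (hδ : 0 ≤ δ) (hδM : 3 * δ * M ^ 2 ≤ c)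
    (hsymm : ∀ l i, k l i = k i l) (hkm : ∀ l i, AEStronglyMeasurable (k l i) μ)
    (hk : ∀ᵐ x ∂μ, ∀ l i, 0 ≤ k l i x)
    (hσt : AEStronglyMeasurable σt μ) (hσtM : ∀ᵐ x ∂μ, |σt x| ≤ M)
    (hσs : AEStronglyMeasurable σs μ) (hσs0 : ∀ᵐ x ∂μ, 0 ≤ σs x)
    (hs : ∀ x l, ∑ i, w i * k l i x ≤ s x)
    (hcoer : ∀ᵐ x ∂μ, c ≤ σt x - s x * σs x)
    {u D : ι → α → ℝ} (hu : ∀ l, MemLp (u l) 2 μ) (hD : ∀ l, MemLp (D l) 2 μ) :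
    ∑ l, w l * (c * ∫ x, u l x ^ 2 ∂μ) + δ * ∑ l, w l * ∫ x, D l x ^ 2 ∂μ +
        3 * ∑ l, w l * ∫ x, D l x * u l x ∂μ ≤
      3 * ∑ l, w l * ((∫ x, (D l x + σt x * u l x) * (u l x + δ * D l x) ∂μ) -
        ∫ x, (σs x * ∑ i, w i * k l i x * u i x) * (u l x + δ * D l x) ∂μ) := by
  have hσtb : MemLp σt ⊤ μ := memLp_top_of_bound hσt M hσtM
  -- the row sums of the kernel are bounded by `M`, hence so is each of its entries
  have hrow : ∀ᵐ x ∂μ, ∀ l, ∑ i, w i * (σs x * k l i x) ≤ s x * σs x := by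
    filter_upwards [hσs0] with x hx l
    have := mul_le_mul_of_nonneg_right (hs x l) hx
    refine le_trans (le_of_eq ?_) this
    rw [Finset.sum_mul]; exact Finset.sum_congr rfl fun i _ => by ring
  have hkb : ∀ l i, MemLp (fun x => σs x * k l i x) ⊤ μ := by
    intro l i
    refine memLp_top_of_bound (hσs.mul (hkm l i)) (M / w i) ?_
    filter_upwards [hrow, hk, hσs0, hσtM, hcoer] with x h1 h2 h3 h4 h5
    have h6 : 0 ≤ σs x * k l i x := mul_nonneg h3 (h2 l i)
    rw [Real.norm_of_nonneg h6, le_div_iff₀ (hw i)]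
    have h7 : w i * (σs x * k l i x) ≤ ∑ i, w i * (σs x * k l i x) :=
      Finset.single_le_sum (f := fun i => w i * (σs x * k l i x))
        (fun i _ => mul_nonneg (hw i).le (mul_nonneg h3 (h2 l i))) (Finset.mem_univ i)
    linarith [h1 l, le_abs_self (σt x)]
  have hS : ∀ l, MemLp (fun x => σs x * ∑ i, w i * k l i x * u i x) 2 μ := by
    intro l
    have h1 : MemLp (fun x => ∑ i, w i * ((σs x * k l i x) * u i x)) 2 μ :=
      memLp_finsetSum _ fun i _ => ((hu i).mul (p := ⊤) (hkb l i)).const_mul (w i)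
    refine h1.congr_norm (hσs.mul (Finset.aestronglyMeasurable_fun_sum _ fun i _ =>
      ((hkm l i).const_mul (w i)).mul (hu i).1)) (Filter.Eventually.of_forall fun x => ?_)
    simp only [Finset.mul_sum]
    congr 1
    exact Finset.sum_congr rfl fun i _ => by ring
  have hT : ∀ l, MemLp (fun x => u l x + δ * D l x) 2 μ := fun l => (hu l).add ((hD l).const_mul δ)
  have hA : ∀ l, MemLp (fun x => D l x + σt x * u l x) 2 μ := fun l =>
    (hD l).add ((hu l).mul (p := ⊤) hσtb)
  have i1 : ∀ l, Integrable (fun x => (D l x + σt x * u l x) * (u l x + δ * D l x)) μ :=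
    fun l => (hA l).integrable_mul (hT l)
  have i2 : ∀ l, Integrable (fun x => (σs x * ∑ i, w i * k l i x * u i x) *
      (u l x + δ * D l x)) μ := fun l => (hS l).integrable_mul (hT l)
  have i3 : ∀ l, Integrable (fun x => u l x ^ 2) μ := fun l => (hu l).integrable_sq
  have i4 : ∀ l, Integrable (fun x => D l x ^ 2) μ := fun l => (hD l).integrable_sq
  have i5 : ∀ l, Integrable (fun x => D l x * u l x) μ := fun l => (hD l).integrable_mul (hu l)
  have iL : ∀ l, Integrable (fun x => w l * (c * u l x ^ 2 + δ * D l x ^ 2 +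
      3 * (D l x * u l x))) μ := fun l =>
    ((((i3 l).const_mul c).add ((i4 l).const_mul δ)).add ((i5 l).const_mul 3)).const_mul (w l)
  have iR : ∀ l, Integrable (fun x => w l * (3 * ((D l x + σt x * u l x) * (u l x + δ * D l x) -
      (σs x * ∑ i, w i * k l i x * u i x) * (u l x + δ * D l x)))) μ := fun l =>
    (((i1 l).sub (i2 l)).const_mul 3).const_mul (w l)
  have eL : ∑ l, w l * (c * ∫ x, u l x ^ 2 ∂μ) + δ * ∑ l, w l * ∫ x, D l x ^ 2 ∂μ +
        3 * ∑ l, w l * ∫ x, D l x * u l x ∂μ =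
      ∫ x, ∑ l, w l * (c * u l x ^ 2 + δ * D l x ^ 2 + 3 * (D l x * u l x)) ∂μ := by
    rw [integral_finsetSum _ fun l _ => iL l, Finset.mul_sum, Finset.mul_sum,
      ← Finset.sum_add_distrib, ← Finset.sum_add_distrib]
    refine Finset.sum_congr rfl fun l _ => ?_
    have i6 : Integrable (fun x => c * u l x ^ 2 + δ * D l x ^ 2) μ :=
      ((i3 l).const_mul c).add ((i4 l).const_mul δ)
    rw [integral_const_mul, integral_add i6 ((i5 l).const_mul 3),
      integral_add ((i3 l).const_mul c) ((i4 l).const_mul δ), integral_const_mul,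
      integral_const_mul, integral_const_mul]
    ring
  have eR : 3 * ∑ l, w l * ((∫ x, (D l x + σt x * u l x) * (u l x + δ * D l x) ∂μ) -
        ∫ x, (σs x * ∑ i, w i * k l i x * u i x) * (u l x + δ * D l x) ∂μ) =
      ∫ x, ∑ l, w l * (3 * ((D l x + σt x * u l x) * (u l x + δ * D l x) -
        (σs x * ∑ i, w i * k l i x * u i x) * (u l x + δ * D l x))) ∂μ := by
    rw [integral_finsetSum _ fun l _ => iR l, Finset.mul_sum]
    refine Finset.sum_congr rfl fun l _ => ?_
    rw [integral_const_mul, integral_const_mul, integral_sub (i1 l) (i2 l)]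
    ring
  rw [eL, eR]
  refine integral_mono_ae (integrable_finsetSum _ fun l _ => iL l)
    (integrable_finsetSum _ fun l _ => iR l) ?_
  filter_upwards [hrow, hk, hσs0, hσtM, hcoer] with x h1 h2 h3 h4 h5
  have ha : ∀ l i, 0 ≤ σs x * k l i x := fun l i => mul_nonneg h3 (h2 l i)
  by_cases hne : Nonempty ι
  · obtain ⟨l₀⟩ := hne
    have hs0 : 0 ≤ s x * σs x := le_trans
      (Finset.sum_nonneg fun i _ => mul_nonneg (hw i).le (ha l₀ i)) (h1 l₀)
    have := coercivity_pointwise hw ha (fun l i => by rw [hsymm l i]) h1 hs0 hc h5 hM h4 hδ hδM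
      (fun l => u l x) (fun l => D l x)
    refine this.trans (le_of_eq (Finset.sum_congr rfl fun l _ => ?_))
    rw [Finset.mul_sum]
    congr 4
    exact Finset.sum_congr rfl fun i _ => by ring
  · rw [not_nonempty_iff] at hne
    simp

end Coercivity

/-! ### Coercivity of the bilinear form -/

section Assembly

variable {m L : ℕ} {X : Set (Space (m + 1))}

lemma inner_dir_mem_Icc {d : ℕ} (Q : Quadrature d L) (l i : Fin (L + 1)) :
    inner ℝ (Q.dir l) (Q.dir i) ∈ Set.Icc (-1 : ℝ) 1 := by
  have := abs_real_inner_le_norm (Q.dir l) (Q.dir i)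
  rw [Q.norm_dir, Q.norm_dir, one_mul] at this
  exact abs_le.1 this

lemma sum_le_scatterMax {d : ℕ} (Q : Quadrature d L) (g : Space d → ℝ → ℝ) (x : Space d)
    (l : Fin (L + 1)) :
    ∑ i, Q.weight i * g x (inner ℝ (Q.dir l) (Q.dir i)) ≤ scatterMax Q g x :=
  Finset.le_sup' (fun l : Fin (L + 1) => ∑ i, Q.weight i * g x (inner ℝ (Q.dir l) (Q.dir i)))
    (Finset.mem_univ l)

/-- Coercivity of the bilinear form when the streamline parameter `δ` is small compared with the
coefficients. -/
theorem tripleNormSq_le (hX : IsOpen X) (hXreg : interior (closure X) = X)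
    (Q : Quadrature (m + 1) L) {g : Space (m + 1) → ℝ → ℝ}
    (hg_meas : ∀ t ∈ Set.Icc (-1 : ℝ) 1, AEMeasurable (fun x => g x t) (volume.restrict X))
    (hg_nonneg : ∀ x ∈ X, ∀ t ∈ Set.Icc (-1 : ℝ) 1, 0 ≤ g x t)
    {σt σs : Space (m + 1) → ℝ} (hσt : AEStronglyMeasurable σt (volume.restrict X))
    (hσs : AEStronglyMeasurable σs (volume.restrict X))
    (hσs_nonneg : ∀ᵐ x ∂volume.restrict X, 0 ≤ σs x) {c M δ : ℝ} (hc : 0 < c) (hM : 1 ≤ M)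
    (hσtM : ∀ᵐ x ∂volume.restrict X, |σt x| ≤ M)
    (hcoer : ∀ᵐ x ∂volume.restrict X, c ≤ σt x - scatterMax Q g x * σs x)
    (hδ : 0 ≤ δ) (hδM : 3 * δ * M ^ 2 ≤ c) (T : MeshPartition X)
    {v : Fin (L + 1) → BrokenFun T} (hv : ∀ l, MemBroken T (v l)) :
    tripleNormSq Q c δ T v ≤ 3 * bilinForm Q σt σs g δ T v v := by
  obtain ⟨N, hN⟩ := T.exists_isUnitRep
  have hvol : ∀ j, ∑ l, Q.weight l * (c * ∫ x in T.elem j, v l j x ^ 2) +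
      δ * ∑ l, Q.weight l * (∫ x in T.elem j, dirDeriv T (Q.dir l) (v l) j x ^ 2) +
      3 * ∑ l, Q.weight l * (∫ x in T.elem j, dirDeriv T (Q.dir l) (v l) j x * v l j x) ≤
      3 * ∑ l, Q.weight l * ((∫ x in T.elem j,
        (dirDeriv T (Q.dir l) (v l) j x + σt x * v l j x) *
          (v l j x + δ * dirDeriv T (Q.dir l) (v l) j x)) -
        ∫ x in T.elem j, (σs x * ∑ i, Q.weight i * g x (inner ℝ (Q.dir l) (Q.dir i)) * v i j x) *
          (v l j x + δ * dirDeriv T (Q.dir l) (v l) j x)) := by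
    intro j
    have hsub : interior (T.elem j) ⊆ X := by
      exact (interior_mono (T.elem_subset_closure j)).trans hXreg.subset
    have hle : (volume.restrict (interior (T.elem j)) : Measure (Space (m + 1))) ≤
        volume.restrict X := Measure.restrict_mono hsub le_rfl
    rw [ae_restrict_interior_eq (hN j)]
    refine coercivity_integral (s := scatterMax Q g)
      (k := fun l i x => g x (inner ℝ (Q.dir l) (Q.dir i)))
      (u := fun l => v l j) (D := fun l => dirDeriv T (Q.dir l) (v l) j)
      Q.weight_pos hc hM hδ hδM ?_ ?_ ?_ (hσt.mono_measure hle) (ae_mono hle hσtM)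
      (hσs.mono_measure hle) (ae_mono hle hσs_nonneg) ?_ (ae_mono hle hcoer) ?_ ?_
    · intro l i
      funext x
      rw [real_inner_comm]
    · exact fun l i => ((hg_meas _ (inner_dir_mem_Icc Q l i)).mono_measure hle).aestronglyMeasurable
    · filter_upwards [ae_restrict_mem isOpen_interior.measurableSet] with x hx l i
      exact hg_nonneg x (hsub hx) _ (inner_dir_mem_Icc Q l i)
    · exact fun x l => sum_le_scatterMax Q g x l
    · exact fun l => (hv l j).2.1
    · exact fun l => (weakGrad_spec (hv l j).2).2.const_inner (Q.dir l)
  have hup : ∀ l, 2 * (∑ j, ∫ x in T.elem j, dirDeriv T (Q.dir l) (v l) j x * v l j x) + _ = _ :=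
    fun l => T.upwind_identity hX (Q.norm_dir l) (hv l)
  set A : Fin (L + 1) → Fin T.numElems → ℝ := fun l j => ∫ x in T.elem j,
    (dirDeriv T (Q.dir l) (v l) j x + σt x * v l j x) *
      (v l j x + δ * dirDeriv T (Q.dir l) (v l) j x)
  set S : Fin (L + 1) → Fin T.numElems → ℝ := fun l j => ∫ x in T.elem j,
    (σs x * ∑ i, Q.weight i * g x (inner ℝ (Q.dir l) (Q.dir i)) * v i j x) *
      (v l j x + δ * dirDeriv T (Q.dir l) (v l) j x)
  set U : Fin (L + 1) → Fin T.numElems → ℝ := fun l j => ∫ x in T.elem j, v l j x ^ 2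
  set D : Fin (L + 1) → Fin T.numElems → ℝ := fun l j =>
    ∫ x in T.elem j, dirDeriv T (Q.dir l) (v l) j x ^ 2
  set E : Fin (L + 1) → Fin T.numElems → ℝ := fun l j =>
    ∫ x in T.elem j, dirDeriv T (Q.dir l) (v l) j x * v l j x
  set B : Fin (L + 1) → ℝ := fun l => ∑ j, ∫ x in inflow (Q.dir l) (T.elem j),
    jump T (v l) j x * (v l j x * |inner ℝ (Q.dir l) (outwardNormal (T.elem j) x)|) ∂μHE[m]
  set J : Fin (L + 1) → ℝ := fun l => ∑ j, ∫ x in inflow (Q.dir l) (T.elem j),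
    jump T (v l) j x *
      (jump T (v l) j x * |inner ℝ (Q.dir l) (outwardNormal (T.elem j) x)|) ∂μHE[m]
  set O : Fin (L + 1) → ℝ := fun l => ∑ j, ∫ x in outflow (Q.dir l) (T.elem j) ∩ frontier X,
    v l j x * (v l j x * inner ℝ (Q.dir l) (outwardNormal (T.elem j) x)) ∂μHE[m]
  have hJ0 : ∀ l, 0 ≤ J l := fun l => Finset.sum_nonneg fun j _ => integral_nonneg fun x => by
    have := mul_nonneg (mul_self_nonneg (jump T (v l) j x))
      (abs_nonneg (inner ℝ (Q.dir l) (outwardNormal (T.elem j) x)))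
    rwa [mul_assoc] at this
  have hO0 : ∀ l, 0 ≤ O l := fun l => Finset.sum_nonneg fun j _ =>
    setIntegral_nonneg (((hN j).measurableSet_outflow _).inter isClosed_frontier.measurableSet)
      fun x hx => by
        have := mul_nonneg (mul_self_nonneg (v l j x)) hx.1.2
        rwa [mul_assoc] at this
  have hnorm : tripleNormSq Q c δ T v = (∑ l, Q.weight l * ∑ j, c * U l j) +
      (∑ l, Q.weight l * O l) + δ * (∑ l, Q.weight l * ∑ j, D l j) +
      ∑ l, Q.weight l * J l := rfl
  have hform : bilinForm Q σt σs g δ T v v = (∑ l, Q.weight l * ∑ j, A l j) +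
      (∑ l, Q.weight l * B l) - ∑ l, Q.weight l * ∑ j, S l j := rfl
  have hup' : ∀ l, 2 * (∑ j, E l j) + 2 * B l = J l + O l := hup
  have hsum := Finset.sum_le_sum fun j (_ : j ∈ Finset.univ) => hvol j
  have e1 : ∑ j, (∑ l, Q.weight l * (c * U l j) + δ * ∑ l, Q.weight l * D l j +
      3 * ∑ l, Q.weight l * E l j) = (∑ l, Q.weight l * ∑ j, c * U l j) +
      δ * (∑ l, Q.weight l * ∑ j, D l j) + 3 * ∑ l, Q.weight l * ∑ j, E l j := by
    simp only [Finset.mul_sum, Finset.sum_add_distrib]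
    congr 1
    · congr 1 <;> exact Finset.sum_comm
    · exact Finset.sum_comm
  have e2 : ∑ j, 3 * ∑ l, Q.weight l * (A l j - S l j) =
      3 * ((∑ l, Q.weight l * ∑ j, A l j) - ∑ l, Q.weight l * ∑ j, S l j) := by
    rw [← Finset.mul_sum, Finset.sum_comm, ← Finset.sum_sub_distrib]
    congr 1
    refine Finset.sum_congr rfl fun l _ => ?_
    rw [← Finset.mul_sum, Finset.sum_sub_distrib, mul_sub]
  have hsum' := e1.symm.trans_le (hsum.trans_eq e2)
  have e3 : 2 * (∑ l, Q.weight l * ∑ j, E l j) + 2 * (∑ l, Q.weight l * B l) =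
      (∑ l, Q.weight l * J l) + ∑ l, Q.weight l * O l := by
    rw [Finset.mul_sum, Finset.mul_sum, ← Finset.sum_add_distrib, ← Finset.sum_add_distrib]
    refine Finset.sum_congr rfl fun l _ => ?_
    linear_combination Q.weight l * hup' l
  have hJs : 0 ≤ ∑ l, Q.weight l * J l :=
    Finset.sum_nonneg fun l _ => mul_nonneg (Q.weight_pos l).le (hJ0 l)
  have hOs : 0 ≤ ∑ l, Q.weight l * O l :=
    Finset.sum_nonneg fun l _ => mul_nonneg (Q.weight_pos l).le (hO0 l)
  rw [hnorm, hform]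
  linarith

end Assembly

end DODSD
end

theorem lemma4p2 (d L : ℕ) (hd : d = 2 ∨ d = 3)
    (X : Set (DODSD.Space d)) (hX_open : IsOpen X) (hX_conn : IsConnected X)
    (hX_bdd : Bornology.IsBounded X) (hX_reg : interior (closure X) = X)
    (Q : DODSD.Quadrature d L)
    (g : DODSD.Space d → ℝ → ℝ)
    (hg_meas : ∀ t ∈ Set.Icc (-1 : ℝ) 1, AEMeasurable (fun x => g x t) (volume.restrict X))
    (hg_nonneg : ∀ x ∈ X, ∀ t ∈ Set.Icc (-1 : ℝ) 1, 0 ≤ g x t)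
    (σt σs : DODSD.Space d → ℝ)
    (hσt : MemLp σt ⊤ (volume.restrict X)) (hσs : MemLp σs ⊤ (volume.restrict X))
    (hσs_nonneg : ∀ᵐ x ∂volume.restrict X, 0 ≤ σs x)
    (c₀' : ℝ) (hc₀' : 0 < c₀')
    (hcoer : ∀ᵐ x ∂volume.restrict X, c₀' ≤ σt x - DODSD.scatterMax Q g x * σs x)
    (cbar : ℝ) (hcbar : 0 < cbar) :
    ∃ h₀ : ℝ, 0 < h₀ ∧ ∀ h : ℝ, 0 < h → h ≤ h₀ →
      ∀ T : DODSD.MeshPartition X, (∀ j, Metric.diam (T.elem j) ≤ h) →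
        ∀ v : Fin (L + 1) → DODSD.BrokenFun T, (∀ l, DODSD.MemBroken T (v l)) →
          DODSD.tripleNormSq Q c₀' (cbar * h) T v ≤
            3 * DODSD.bilinForm Q σt σs g (cbar * h) T v v := by
  obtain ⟨m, rfl⟩ : ∃ m, d = m + 1 := by
    rcases hd with rfl | rfl
    exacts [⟨1, rfl⟩, ⟨2, rfl⟩]
  obtain ⟨M, hM, hσtM⟩ := DODSD.memLp_top_ae_bound hσt
  refine ⟨c₀' / (3 * cbar * M ^ 2), by positivity, fun h hh hh₀ T _ v hv => ?_⟩
  refine DODSD.tripleNormSq_le hX_open hX_reg Q hg_meas hg_nonneg hσt.1 hσs.1 hσs_nonneg hc₀' hM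
    hσtM hcoer (by positivity) ?_ T hv
  rw [le_div_iff₀ (by positivity)] at hh₀
  linarith
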